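/- Let $p,q\in[0,1]$ with $p+q>0$. The heralding coin $\mathcal P_h^+$ is the stationary process $(X_t)_{t\in\mathbb Z}$ over $\{0,1,2\}$ generated by the machine with two states $0,1$ which, from state $0$, emits $0$ and stays with probability $1-p$ or emits $1$ and moves to state $1$ with probability $p$, and, from state $1$, emits $2$ and moves to state $0$ with probability $q$ or emits $1$ and stays with probability $1-q$; its stationary state distribution is $\pi_0=q/(p+q)$, $\pi_1=p/(p+q)$. (After an output $1$ the machine is in state $1$, after an output $0$ or $2$ in state $0$.) A quantum causal model of a process is a tuple $\mathcal Q=(f,\Omega,\mathcal M)$, where $\Omega$ is a set of pure states (unit vectors) of a quantum system with a separable Hilbert space of finite or infinite dimension, $f$ encodes pasts $x=\dots x_{-2}x_{-1}$ into $\Omega$ (measurably), and $\mathcal M$ is a quantum measurement process (quantum instrument) on that system such that, for almost every past $x$, applying $\mathcal M$ to the state $f(x)$ (i) outputs each symbol $a$ with probability $P(X_0=a\mid x)$ and (ii) upon an output $a$ of non-zero probability leaves the system in the state $f(xa)$. Its entropy is $C_q(\mathcal Q)=S(\rho)=-\mathrm{Tr}(\rho\log_2\rho)\in[0,\infty]$,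 where $\rho=\int |f(x)\rangle\langle f(x)|\,dP(x)$ is the average memory state. $\mathcal Q$ is optimal if $C_q(\mathcal Q)\le C_q(\mathcal Q')$ for every quantum causal model $\mathcal Q'$ of the process. Let $\mathcal Q^+=(\varepsilon^+,\Omega^+,\mathcal M^+)$ with $\Omega^+=\{|s_0^+\rangle,|s_1^+\rangle\}\subset\mathbb C^3$, $$|s_0^+\rangle=\sqrt{1-p}\,|0\rangle+\sqrt p\,|1\rangle,\qquad |s_1^+\rangle=\sqrt q\,|2\rangle+\sqrt{1-q}\,|1\rangle,$$ $\varepsilon^+(x)=|s_1^+\rangle$ if $x_{-1}=1$ and $\varepsilon^+(x)=|s_0^+\rangle$ otherwise, and $\mathcal M^+$ the following circuit: adjoin to the memory (first register) an ancilla (second register) in the state $|0\rangle\in\mathbb C^3$, apply $V_p$ to the ancilla, then the controlled gate $C_{V_q}:|w\rangle|\psi\rangle\mapsto|w\rangle V_q^{\,w\bmod 2}|\psi\rangle$, measure the first register in the computational basis to obtain the output, and keep the second register as the new memory; here $V_p,V_q$ are unitaries on $\mathbb C^3$ with $V_p|0\rangle=|s_0^+\rangle$ and $V_qV_p|0\rangle=|s_1^+\rangle$.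 Then such unitaries $V_p,V_q$ exist, and for every choice of them $\mathcal Q^+$ is an optimal quantum causal model of the heralding coin $\mathcal P_h^+$. -/

import Mathlib

open MeasureTheory ProbabilityTheory
open scoped ENNReal Kronecker

universe u

noncomputable section

/-! ### Stochastic processes over an alphabet `A`

A process is a probability measure on the bi-infinite sequences `ℤ → A`. A past
`… x₋₂ x₋₁` is stored as a sequence `x : ℕ → A` read backwards in time, `x k = x₋₍ₖ₊₁₎`. -/

/-- The past `… ω₋₂ ω₋₁` of a bi-infinite sequence. -/
def pastOf {A : Type*} (ω : ℤ → A) : ℕ → A := fun k => ω (-((k : ℤ) + 1))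

/-- The past `x a`, obtained from the past `x` once the symbol `a` has been emitted. -/
def pastSnoc {A : Type*} (x : ℕ → A) (a : A) : ℕ → A
  | 0 => a
  | k + 1 => x k

/-- The distribution of the past. -/
def pastLaw {A : Type*} [MeasurableSpace A] (P : Measure (ℤ → A)) : Measure (ℕ → A) :=
  P.map pastOf

/-- `P(X₀ = a | past = x)`, through the regular conditional distribution. -/
def nextProb {A : Type*} [MeasurableSpace A] [StandardBorelSpace A] [Nonempty A]
    (P : Measure (ℤ → A)) [IsFiniteMeasure P] (x : ℕ → A) (a : A) : ℝ :=
  (condDistrib (fun ω : ℤ → A => ω 0) pastOf P x).real {a}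

/-! ### Quantum states, instruments and entropy -/

/-- The operator `|ψ⟩⟨ψ|`. -/
def pureState {H : Type*} [NormedAddCommGroup H] [InnerProductSpace ℂ H] (ψ : H) : H →L[ℂ] H :=
  InnerProductSpace.rankOne ℂ ψ ψ

/-- The von Neumann entropy `-Tr(ρ log₂ ρ)` of a density operator, as a value in `[0, ∞]`:
the sum of `-λ log₂ λ` over the eigenvalues `λ` of `ρ`, counted with multiplicity. -/
def vonNeumannEntropy {H : Type*} [NormedAddCommGroup H] [InnerProductSpace ℂ H]
    (ρ : H →L[ℂ] H) : ℝ≥0∞ :=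
  ∑' lam : ℝ,
    (Module.finrank ℂ (Module.End.eigenspace (ρ : H →ₗ[ℂ] H) (lam : ℂ)) : ℝ≥0∞) *
      ENNReal.ofReal (Real.negMulLog lam / Real.log 2)

/-- A quantum measurement process with outcomes in `A` (a quantum instrument), in Kraus form:
outcome `a` acts by the completely positive map `ρ ↦ ∑ₖ K_{a,k} ρ K_{a,k}†`, and
`∑_{a,k} K_{a,k}† K_{a,k} = 1` (written through the quadratic forms of both sides). -/
structure QuantumInstrument (A : Type*) (H : Type*) [NormedAddCommGroup H]
    [InnerProductSpace ℂ H] where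
  ι : Type
  kraus : A → ι → H →L[ℂ] H
  complete : ∀ ψ : H, HasSum (fun k : A × ι => ‖kraus k.1 k.2 ψ‖ ^ 2) (‖ψ‖ ^ 2)

namespace QuantumInstrument

variable {A H : Type*} [NormedAddCommGroup H] [InnerProductSpace ℂ H]

/-- Measuring the pure state `ψ` gives the outcome `a` with probability `r`. -/
def OutcomeProb (M : QuantumInstrument A H) (ψ : H) (a : A) (r : ℝ) : Prop :=
  HasSum (fun k => ‖M.kraus a k ψ‖ ^ 2) r

/-- The unnormalised post-measurement state of the pure state `ψ` for the outcome `a`,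
`∑ₖ K_{a,k} |ψ⟩⟨ψ| K_{a,k}†`, is `σ`. -/
def PostState (M : QuantumInstrument A H) (ψ : H) (a : A) (σ : H →L[ℂ] H) : Prop :=
  HasSum (fun k => pureState (M.kraus a k ψ)) σ

end QuantumInstrument

/-! ### Quantum causal models -/

/-- A tuple `(f, Ω, M)`: a set `Ω` of (pure) states of a quantum system with state space `H`,
an encoding `f` of pasts into `Ω`, and a measurement process `M` on the system. -/
structure QuantumTuple (A : Type*) (H : Type*) [NormedAddCommGroup H]
    [InnerProductSpace ℂ H] where
  states : Set H
  states_unit : ∀ ψ ∈ states, ‖ψ‖ = 1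
  encode : (ℕ → A) → H
  encode_mem : ∀ x, encode x ∈ states
  process : QuantumInstrument A H

section Models

variable {A : Type*} [MeasurableSpace A]

/-- The average memory state `ρ = ∑ₓ P(x) |f(x)⟩⟨f(x)|`, the sum over pasts being an integral. -/
def QuantumTuple.averageState {H : Type*} [NormedAddCommGroup H] [InnerProductSpace ℂ H]
    (Q : QuantumTuple A H) (P : Measure (ℤ → A)) : H →L[ℂ] H :=
  ∫ x, pureState (Q.encode x) ∂(pastLaw P)

/-- The entropy `C_q(Q) = S(ρ)` of a tuple for the process `P`. -/
def QuantumTuple.complexity {H : Type*} [NormedAddCommGroup H] [InnerProductSpace ℂ H]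
    (Q : QuantumTuple A H) (P : Measure (ℤ → A)) : ℝ≥0∞ :=
  vonNeumannEntropy (Q.averageState P)

variable [StandardBorelSpace A] [Nonempty A]

/-- `Q` is a quantum causal model of the process `P`: for (almost) every past `x`, if the memory
is in the state `f(x)`, then the measurement process
(i) outputs each `a` with probability `P(X₀ = a | past = x)`, and
(ii) if that probability is not zero, then leaves the memory in the state `f(xa)`. -/
structure IsQuantumModel {H : Type*} [NormedAddCommGroup H] [InnerProductSpace ℂ H]
    (P : Measure (ℤ → A)) [IsFiniteMeasure P] (Q : QuantumTuple A H) : Prop where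
  measurable : AEStronglyMeasurable (fun x => pureState (Q.encode x)) (pastLaw P)
  output : ∀ᵐ x ∂(pastLaw P), ∀ a,
    Q.process.OutcomeProb (Q.encode x) a (nextProb P x a)
  transition : ∀ᵐ x ∂(pastLaw P), ∀ a, nextProb P x a ≠ 0 →
    Q.process.PostState (Q.encode x) a
      ((nextProb P x a : ℂ) • pureState (Q.encode (pastSnoc x a)))

/-- `Q` is an optimal quantum model of `P`: it is a quantum model of `P`, and every quantum model
of `P`, on any separable Hilbert space (of finite or infinite dimension), has at least its
entropy. -/
def IsOptimalQuantumModel.{v, w, z} {A : Type w} [MeasurableSpace A] [StandardBorelSpace A]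
    [Nonempty A] {H : Type z} [NormedAddCommGroup H] [InnerProductSpace ℂ H]
    (P : Measure (ℤ → A)) [IsFiniteMeasure P] (Q : QuantumTuple A H) : Prop :=
  IsQuantumModel P Q ∧
    ∀ (H' : Type v) [NormedAddCommGroup H'] [InnerProductSpace ℂ H'] [CompleteSpace H']
      [TopologicalSpace.SeparableSpace H'] (Q' : QuantumTuple A H'),
      IsQuantumModel P Q' → Q.complexity P ≤ Q'.complexity P

end Models

/-! ### The heralding coin -/

namespace HeraldingCoin

/-- The transition probabilities `T i x j` of the generating machine: in state `i` it emits `x`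
and moves to `j`. State `1` means that the last output was `1`, state `0` that it was `0` or
`2`. -/
def transProb (p q : ℝ) : Fin 2 → Fin 3 → Fin 2 → ℝ
  | 0, 0, 0 => 1 - p
  | 0, 1, 1 => p
  | 1, 2, 0 => q
  | 1, 1, 1 => 1 - q
  | _, _, _ => 0

/-- The stationary distribution of the machine. -/
def statProb (p q : ℝ) : Fin 2 → ℝ := ![q / (p + q), p / (p + q)]

/-- The probability that the machine, started in state `i`, emits the word `w`. -/
def wordProb (p q : ℝ) : Fin 2 → List (Fin 3) → ℝ
  | _, [] => 1
  | i, x :: w => ∑ j, transProb p q i x j * wordProb p q j w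

/-- `P` is the law of the heralding coin: the stationary process generated by the machine.
Every word `w` occurs at every time `t` with probability `∑ᵢ πᵢ P(w | i)`. -/
def IsLaw (p q : ℝ) (P : Measure (ℤ → Fin 3)) : Prop :=
  ∀ (t : ℤ) (w : List (Fin 3)),
    P {ω | ∀ k : Fin w.length, ω (t + (k : ℕ)) = w.get k} =
      ENNReal.ofReal (∑ i, statProb p q i * wordProb p q i w)

/-- A three-level quantum system. -/
abbrev Qutrit : Type := EuclideanSpace ℂ (Fin 3)

/-- The code word `|s₀⁺⟩ = √(1-p) |0⟩ + √p |1⟩`. -/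
def s₀ (p : ℝ) : Qutrit := !₂[(Real.sqrt (1 - p) : ℂ), (Real.sqrt p : ℂ), 0]

/-- The code word `|s₁⁺⟩ = √q |2⟩ + √(1-q) |1⟩`. -/
def s₁ (q : ℝ) : Qutrit := !₂[0, (Real.sqrt (1 - q) : ℂ), (Real.sqrt q : ℂ)]

/-- The encoding: pasts that end in `1` go to `|s₁⁺⟩`, all others to `|s₀⁺⟩`. -/
def encode (p q : ℝ) (x : ℕ → Fin 3) : Qutrit := if x 0 = 1 then s₁ q else s₀ p

/-- The controlled gate `C_U : |w⟩|ψ⟩ ↦ |w⟩ U^(w mod 2) |ψ⟩` on two qutrits. -/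
def ctrl (U : Matrix (Fin 3) (Fin 3) ℂ) : Matrix (Fin 3 × Fin 3) (Fin 3 × Fin 3) ℂ :=
  Matrix.of fun a b => if a.1 = b.1 then (U ^ (b.1.val % 2)) a.2 b.2 else 0

/-- The circuit: `V_p` on the second qutrit, then `C_{V_q}` controlled by the first one. -/
def circuit (Vp Vq : Matrix (Fin 3) (Fin 3) ℂ) : Matrix (Fin 3 × Fin 3) (Fin 3 × Fin 3) ℂ :=
  ctrl Vq * ((1 : Matrix (Fin 3) (Fin 3) ℂ) ⊗ₖ Vp)

/-- The operator on the memory for the outcome `x`, `(⟨x| ⊗ 1) · circuit · (1 ⊗ |0⟩)`: adjoin an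
ancilla in the state `|0⟩`, run the circuit, measure the first qutrit in the computational basis
with outcome `x`, and keep the second qutrit as the new memory. -/
def krausMatrix (Vp Vq : Matrix (Fin 3) (Fin 3) ℂ) (x : Fin 3) : Matrix (Fin 3) (Fin 3) ℂ :=
  Matrix.of fun i w => circuit Vp Vq (x, i) (w, 0)

/-- `V_p` and `V_q` are gates of the circuit: `V_p |0⟩ = |s₀⁺⟩` and `V_q V_p |0⟩ = |s₁⁺⟩`. -/
def IsGates (p q : ℝ) (Vp Vq : Matrix.unitaryGroup (Fin 3) ℂ) : Prop :=
  Matrix.toEuclideanLin (Vp : Matrix (Fin 3) (Fin 3) ℂ) (EuclideanSpace.single 0 1) = s₀ p ∧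
    Matrix.toEuclideanLin ((Vq : Matrix (Fin 3) (Fin 3) ℂ) * (Vp : Matrix (Fin 3) (Fin 3) ℂ))
      (EuclideanSpace.single 0 1) = s₁ q

theorem norm_s₀ {p : ℝ} (hp : p ∈ Set.Icc (0 : ℝ) 1) : ‖s₀ p‖ = 1 := by
  have h1 : 0 ≤ 1 - p := sub_nonneg.2 hp.2
  simp [s₀, EuclideanSpace.norm_eq, Fin.sum_univ_three, Real.sq_sqrt h1, Real.sq_sqrt hp.1]

theorem norm_s₁ {q : ℝ} (hq : q ∈ Set.Icc (0 : ℝ) 1) : ‖s₁ q‖ = 1 := by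
  have h1 : 0 ≤ 1 - q := sub_nonneg.2 hq.2
  simp [s₁, EuclideanSpace.norm_eq, Fin.sum_univ_three, Real.sq_sqrt h1, Real.sq_sqrt hq.1]

theorem krausMatrix_apply (Vp Vq : Matrix (Fin 3) (Fin 3) ℂ) (x i w : Fin 3) :
    krausMatrix Vp Vq x i w = if x = w then (Vq ^ (x.val % 2) * Vp) i 0 else 0 := by
  simp only [krausMatrix, circuit, ctrl, Matrix.of_apply, Matrix.mul_apply,
    Fintype.sum_prod_type, Matrix.kroneckerMap_apply, Matrix.one_apply]
  rw [Finset.sum_eq_single x]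
  · by_cases h : x = w <;> simp [h]
  · intro b _ hb
    simp [Ne.symm hb]
  · simp

theorem sum_norm_sq_col (U : Matrix.unitaryGroup (Fin 3) ℂ) :
    ∑ i, ‖(U : Matrix (Fin 3) (Fin 3) ℂ) i 0‖ ^ 2 = 1 := by
  have h := congrFun (congrFun (Matrix.mem_unitaryGroup_iff'.1 U.2) 0) 0
  simp only [Matrix.mul_apply, Matrix.star_apply, Matrix.one_apply_eq] at h
  have h2 : ((∑ i, ‖(U : Matrix (Fin 3) (Fin 3) ℂ) i 0‖ ^ 2 : ℝ) : ℂ) = 1 := by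
    rw [← h]
    push_cast
    refine Finset.sum_congr rfl fun i _ => ?_
    exact (Complex.conj_mul' _).symm
  exact_mod_cast h2

/-- The measurement process given by the circuit. -/
def process (Vp Vq : Matrix.unitaryGroup (Fin 3) ℂ) : QuantumInstrument (Fin 3) Qutrit where
  ι := Unit
  kraus x _ := Matrix.toEuclideanCLM (𝕜 := ℂ) (krausMatrix (Vp : Matrix (Fin 3) (Fin 3) ℂ) Vq x)
  complete ψ := by
    have key : ∀ x : Fin 3, ‖Matrix.toEuclideanCLM (𝕜 := ℂ)
        (krausMatrix (Vp : Matrix (Fin 3) (Fin 3) ℂ) Vq x) ψ‖ ^ 2 = ‖ψ x‖ ^ 2 := by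
      intro x
      have h := sum_norm_sq_col (Vq ^ (x.val % 2) * Vp)
      rw [EuclideanSpace.norm_sq_eq]
      simp only [Matrix.ofLp_toEuclideanCLM, Matrix.mulVec, dotProduct, krausMatrix_apply,
        ite_mul, zero_mul, Finset.sum_ite_eq, Finset.mem_univ, if_true, norm_mul, mul_pow]
      rw [← Finset.sum_mul]
      simp only [Submonoid.coe_mul, SubmonoidClass.coe_pow] at h
      rw [h, one_mul]
    have e : ‖ψ‖ ^ 2 = ∑ k : Fin 3 × Unit, ‖Matrix.toEuclideanCLM (𝕜 := ℂ)
        (krausMatrix (Vp : Matrix (Fin 3) (Fin 3) ℂ) Vq k.1) ψ‖ ^ 2 := by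
      rw [EuclideanSpace.norm_sq_eq, Fintype.sum_prod_type]
      simp [key]
    rw [e]
    exact hasSum_fintype _

/-- The tuple `Q⁺ = (ε⁺, Ω⁺, M⁺)` with `Ω⁺ = {|s₀⁺⟩, |s₁⁺⟩}`. -/
def model (p q : ℝ) (hp : p ∈ Set.Icc (0 : ℝ) 1) (hq : q ∈ Set.Icc (0 : ℝ) 1)
    (Vp Vq : Matrix.unitaryGroup (Fin 3) ℂ) : QuantumTuple (Fin 3) Qutrit where
  states := {s₀ p, s₁ q}
  states_unit := by
    rintro ψ (rfl | rfl)
    · exact norm_s₀ hp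
    · exact norm_s₁ hq
  encode := encode p q
  encode_mem x := by
    unfold encode
    split_ifs <;> simp
  process := process Vp Vq

end HeraldingCoin

end

/-! The lower bound is an overlap argument. State `0` of the machine never emits `2` and state `1`
never emits `0`, so a past ending in `1` and a past not ending in `1` have only the output `1` in
common. An instrument preserves inner products once all Kraus branches are summed, and here only the
branches of output `1` survive. Cauchy–Schwarz then bounds the overlap of the two memory states by
`√(p(1-q))` in every model (`QuantumInstrument.norm_inner_le`).

Let `M` be the larger eigenvalue of the Gram matrix of two states with weights `π₁`, `π₀` and
exactly this overlap. Small overlaps between the two classes of pasts force every eigenvalue of the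
average state to be at most `M`, however many states each class uses
(`eigenvalue_integral_pureState_le`). The eigenvalues form a probability vector, and since `M ≥ 1/2`
its entropy is at least that of `(M, 1 - M)` (`binEntropy_le_tsum_entropyTerm`).

The circuit attains the bound: its two code words have overlap exactly `√(p(1-q))`, so its average
state has nonzero spectrum in `{M, 1 - M}` and the entropy of `(M, 1 - M)`
(`vonNeumannEntropy_mixture`). That it is a model follows from the output fixing the next machine
state, which identifies the conditional law of the next symbol (`IsLaw.nextProb_ae_eq`). -/

noncomputable section

/-! ### Entropy as a sum over an eigenbasis, and spectra of averages of pure states. -/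

section SpectralEntropy

variable {H : Type*} [NormedAddCommGroup H] [InnerProductSpace ℂ H]

/-- Distinct orthonormal vectors are at distance `√2`, so balls of radius `1/2` around them are
disjoint open sets. Countability is needed later to exchange a sum over eigenvectors with an
integral. -/
theorem Orthonormal.countable_index [TopologicalSpace.SeparableSpace H] {ι : Type*} {v : ι → H}
    (hv : Orthonormal ℂ v) : Countable ι := by
  have hdist : ∀ i j, i ≠ j → 1 ≤ dist (v i) (v j) := by
    intro i j hij
    have h : ‖v i - v j‖ ^ 2 = 2 := by
      rw [@norm_sub_sq ℂ, hv.1 i, hv.1 j, hv.2 hij]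
      norm_num
    rw [dist_eq_norm]
    nlinarith [norm_nonneg (v i - v j)]
  refine Pairwise.countable_of_isOpen_disjoint (s := fun i => Metric.ball (v i) (1 / 2)) ?_
    (fun i => Metric.isOpen_ball) fun i => Metric.nonempty_ball.2 (by norm_num)
  intro i j hij
  exact Metric.ball_disjoint_ball (by linarith [hdist i j hij])

theorem HilbertBasis.finrank_eq_card {ι : Type*} [Fintype ι] (b : HilbertBasis ι ℂ H) :
    Module.finrank ℂ H = Fintype.card ι :=
  Module.finrank_eq_card_basis b.toOrthonormalBasis.toBasis

/-- The contribution of an eigenvalue `x` to the entropy, in bits. -/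
def entropyTerm (x : ℝ) : ℝ≥0∞ := ENNReal.ofReal (Real.negMulLog x / Real.log 2)

@[simp] theorem entropyTerm_zero : entropyTerm 0 = 0 := by simp [entropyTerm]

/-- The eigenspace of a continuous operator at a real number. -/
def realEigenspace (T : H →L[ℂ] H) (x : ℝ) : Submodule ℂ H :=
  Module.End.eigenspace (T : H →ₗ[ℂ] H) (x : ℂ)

theorem mem_realEigenspace {T : H →L[ℂ] H} {x : ℝ} {v : H} :
    v ∈ realEigenspace T x ↔ T v = (x : ℂ) • v :=
  Module.End.mem_eigenspace_iff

theorem isClosed_realEigenspace (T : H →L[ℂ] H) (x : ℝ) :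
    IsClosed (realEigenspace T x : Set H) := by
  have : (realEigenspace T x : Set H) = {v | T v = (x : ℂ) • v} := by
    ext v
    exact mem_realEigenspace
  rw [this]
  exact isClosed_eq T.continuous (continuous_const_smul _)

theorem eigenspace_le_iSup_realEigenspace {T : H →L[ℂ] H} (hs : (T : H →ₗ[ℂ] H).IsSymmetric)
    (μ : ℂ) : Module.End.eigenspace (T : H →ₗ[ℂ] H) μ ≤ ⨆ x, realEigenspace T x := by
  by_cases h : Module.End.HasEigenvalue (T : H →ₗ[ℂ] H) μ
  · have hμ : ((μ.re : ℝ) : ℂ) = μ := Complex.conj_eq_iff_re.1 (hs.conj_eigenvalue_eq_self h)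
    refine le_trans (le_of_eq ?_) (le_iSup _ μ.re)
    rw [realEigenspace, hμ]
  · rw [Module.End.hasEigenvalue_iff, not_not] at h
    rw [h]
    exact bot_le

theorem HilbertBasis.le_orthogonal_orthogonal {ι : Type*} {K : Submodule ℂ H}
    (b : HilbertBasis ι ℂ K) {S : Set H} (hS : ∀ i, (b i : H) ∈ S) :
    K ≤ (Submodule.span ℂ S)ᗮᗮ := by
  intro e he
  rw [Submodule.mem_orthogonal]
  intro u hu
  have h := (b.hasSum_repr ⟨e, he⟩).mapL ((innerSL ℂ u).comp K.subtypeL)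
  have h0 : ∀ i, ((innerSL ℂ u).comp K.subtypeL) (b.repr ⟨e, he⟩ i • b i) = 0 := by
    intro i
    have : inner ℂ u (b i : H) = 0 :=
      (Submodule.mem_orthogonal' _ u).1 hu _ (Submodule.subset_span (hS i))
    simp [this]
  simp only [h0] at h
  exact (h.unique hasSum_zero)

theorem orthogonalFamily_realEigenspace {T : H →L[ℂ] H} (hs : (T : H →ₗ[ℂ] H).IsSymmetric) :
    OrthogonalFamily ℂ (fun x => realEigenspace T x) fun x => (realEigenspace T x).subtypeₗᵢ :=
  hs.orthogonalFamily_eigenspaces.comp Complex.ofReal_injective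

theorem orthogonal_iSup_realEigenspace [CompleteSpace H] {T : H →L[ℂ] H}
    (hc : IsCompactOperator T) (hs : (T : H →ₗ[ℂ] H).IsSymmetric) :
    (⨆ x, realEigenspace T x)ᗮ = ⊥ := by
  rw [eq_bot_iff, ← ContinuousLinearMap.orthogonalComplement_iSup_eigenspaces_eq_bot hc hs]
  exact Submodule.orthogonal_le (iSup_le fun μ => eigenspace_le_iSup_realEigenspace hs μ)

theorem vonNeumannEntropy_eq_tsum_sigma [CompleteSpace H] {T : H →L[ℂ] H}
    (hc : IsCompactOperator T) {w : ℝ → Type*}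
    (b : ∀ x, HilbertBasis (w x) ℂ (realEigenspace T x)) :
    vonNeumannEntropy T = ∑' i : (Σ x : ℝ, w x), entropyTerm i.1 := by
  rw [ENNReal.tsum_sigma', vonNeumannEntropy]
  refine tsum_congr fun x => ?_
  -- The kernel may be infinite-dimensional, but the eigenvalue `0` contributes nothing on either
  -- side. The other eigenspaces are finite-dimensional by compactness.
  rcases eq_or_ne x 0 with rfl | hx
  · simp
  · have hfin : FiniteDimensional ℂ (realEigenspace T x) :=
      ContinuousLinearMap.finite_dimensional_eigenspace hc (x : ℂ) (by exact_mod_cast hx)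
    have : Finite (w x) := (b x).orthonormal.linearIndependent.finite
    have := Fintype.ofFinite (w x)
    have hcard := (b x).finrank_eq_card
    rw [realEigenspace] at hcard
    simp only
    rw [tsum_fintype, Finset.sum_const, Finset.card_univ, hcard, nsmul_eq_mul, entropyTerm]

/-- A compact symmetric operator on a separable Hilbert space has a countable Hilbert basis of
eigenvectors, and its entropy is the sum of the contributions of the basis vectors. -/
theorem exists_eigenbasis_entropy {H : Type u} [NormedAddCommGroup H] [InnerProductSpace ℂ H]
    [CompleteSpace H] [TopologicalSpace.SeparableSpace H]
    {T : H →L[ℂ] H} (hc : IsCompactOperator T) (hs : (T : H →ₗ[ℂ] H).IsSymmetric) :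
    ∃ (ι : Type u) (b : HilbertBasis ι ℂ H) (lam : ι → ℝ), Countable ι ∧
      (∀ i, T (b i) = (lam i : ℂ) • b i) ∧ vonNeumannEntropy T = ∑' i, entropyTerm (lam i) := by
  have hEc : ∀ x, CompleteSpace (realEigenspace T x) :=
    fun x => (isClosed_realEigenspace T x).completeSpace_coe
  have hex : ∀ x, ∃ (w : Set (realEigenspace T x)),
      Nonempty (HilbertBasis w ℂ (realEigenspace T x)) := fun x =>
    let ⟨w, b, _⟩ := exists_hilbertBasis ℂ (realEigenspace T x)
    ⟨w, ⟨b⟩⟩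
  choose w hw using hex
  have b := fun x => (hw x).some
  obtain ⟨v, hv⟩ : ∃ v : (Σ x : ℝ, w x) → H, ∀ i, v i = ((b i.1 i.2 : realEigenspace T i.1) : H) :=
    ⟨_, fun _ => rfl⟩
  have hortho : Orthonormal ℂ v := by
    rw [funext hv]
    exact (orthogonalFamily_realEigenspace hs).orthonormal_sigma_orthonormal
      fun x => (b x).orthonormal
  -- Each eigenspace lies only in the double complement of the span, not in the span itself; the
  -- identity `Kᗮᗮᗮ = Kᗮ` makes this sufficient.
  have hspan : (Submodule.span ℂ (Set.range v))ᗮ = ⊥ := by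
    rw [eq_bot_iff, ← orthogonal_iSup_realEigenspace hc hs,
      ← Submodule.triorthogonal_eq_orthogonal (K := Submodule.span ℂ (Set.range v))]
    exact Submodule.orthogonal_le (iSup_le fun x =>
      (b x).le_orthogonal_orthogonal fun i => ⟨⟨x, i⟩, hv _⟩)
  refine ⟨_, HilbertBasis.mkOfOrthogonalEqBot hortho hspan, fun i => i.1, hortho.countable_index,
    fun i => ?_, vonNeumannEntropy_eq_tsum_sigma hc b⟩
  rw [HilbertBasis.coe_mkOfOrthogonalEqBot, hv]
  exact mem_realEigenspace.1 (b i.1 i.2).2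

/-! ### Averages of pure states -/

theorem pureState_apply (ψ v : H) : pureState ψ v = inner ℂ ψ v • ψ := rfl

theorem norm_pureState (ψ : H) : ‖pureState ψ‖ = ‖ψ‖ * ‖ψ‖ := InnerProductSpace.norm_rankOne ψ ψ

theorem inner_pureState_apply (ψ v : H) :
    inner ℂ v (pureState ψ v) = ((‖inner ℂ ψ v‖ ^ 2 : ℝ) : ℂ) := by
  rw [pureState_apply, inner_smul_right, ← inner_conj_symm v ψ, Complex.mul_conj']
  push_cast
  rfl

theorem isCompactOperator_pureState (ψ : H) : IsCompactOperator (pureState ψ) := by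
  have h : IsCompactOperator (innerSL ℂ ψ) :=
    isCompactOperator_of_locallyCompactSpace_dom (innerSL ℂ ψ)
  exact h.clm_comp (ContinuousLinearMap.toSpanSingleton ℂ ψ)

variable {X : Type*} [MeasurableSpace X] {μ : Measure X} {f : X → H}

theorem integrable_pureState [IsFiniteMeasure μ]
    (hm : AEStronglyMeasurable (fun x => pureState (f x)) μ) (hf : ∀ x, ‖f x‖ = 1) :
    Integrable (fun x => pureState (f x)) μ :=
  Integrable.of_bound hm 1 (Filter.Eventually.of_forall fun x => by simp [norm_pureState, hf])

/-- Compact operators form a closed convex set, and a probability average cannot leave such a set.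
-/
theorem isCompactOperator_integral_pureState [CompleteSpace H] [IsProbabilityMeasure μ]
    (hi : Integrable (fun x => pureState (f x)) μ) :
    IsCompactOperator (∫ x, pureState (f x) ∂μ : H →L[ℂ] H) := by
  have hcl : IsClosed {T : H →L[ℂ] H | IsCompactOperator T} := isClosed_setOfPred_isCompactOperator
  refine Convex.integral_mem ?_ hcl
    (Filter.Eventually.of_forall fun x => isCompactOperator_pureState (f x)) hi
  intro S hS T hT a c _ _ _
  exact (hS.smul a).add (hT.smul c)

theorem inner_integral_pureState_apply [CompleteSpace H]
    (hi : Integrable (fun x => pureState (f x)) μ) (v w : H) :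
    inner ℂ w ((∫ x, pureState (f x) ∂μ) v) = ∫ x, inner ℂ w (pureState (f x) v) ∂μ := by
  rw [ContinuousLinearMap.integral_apply hi, integral_inner (hi.apply_continuousLinearMap v)]

theorem isSymmetric_integral_pureState [CompleteSpace H]
    (hi : Integrable (fun x => pureState (f x)) μ) :
    ((∫ x, pureState (f x) ∂μ : H →L[ℂ] H) : H →ₗ[ℂ] H).IsSymmetric := by
  intro v w
  simp only [ContinuousLinearMap.coe_coe]
  rw [inner_integral_pureState_apply hi, ← inner_conj_symm, inner_integral_pureState_apply hi,
    ← integral_conj]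
  refine integral_congr_ae (Filter.Eventually.of_forall fun x => ?_)
  simp only [pureState_apply, inner_smul_right, map_mul, inner_conj_symm]
  ring

theorem integrable_norm_inner_sq (hi : Integrable (fun x => pureState (f x)) μ) (v : H) :
    Integrable (fun x => ‖inner ℂ (f x) v‖ ^ 2) μ := by
  have h := ((hi.apply_continuousLinearMap v).const_inner (𝕜 := ℂ) v).re
  refine h.congr (Filter.Eventually.of_forall fun x => ?_)
  simp [inner_pureState_apply, -Complex.ofReal_pow]

theorem inner_integral_pureState_self [CompleteSpace H]
    (hi : Integrable (fun x => pureState (f x)) μ) (v : H) :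
    inner ℂ v ((∫ x, pureState (f x) ∂μ) v) = ((∫ x, ‖inner ℂ (f x) v‖ ^ 2 ∂μ : ℝ) : ℂ) := by
  rw [inner_integral_pureState_apply hi]
  simp only [inner_pureState_apply]
  exact integral_ofReal

/-- Obtained by pairing the eigenvalue equation with `v`. It shows at once that eigenvalues are
nonnegative and, through Parseval, what they sum to. -/
theorem eigenvalue_integral_pureState [CompleteSpace H]
    (hi : Integrable (fun x => pureState (f x)) μ) {v : H} (hv : ‖v‖ = 1) {l : ℝ}
    (h : (∫ x, pureState (f x) ∂μ) v = (l : ℂ) • v) :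
    l = ∫ x, ‖inner ℂ (f x) v‖ ^ 2 ∂μ := by
  have h2 := inner_integral_pureState_self hi v
  rw [h, inner_smul_right, inner_self_eq_norm_sq_to_K, hv] at h2
  have h3 : (l : ℂ) = ((∫ x, ‖inner ℂ (f x) v‖ ^ 2 ∂μ : ℝ) : ℂ) := by simpa using h2
  exact_mod_cast h3

theorem HilbertBasis.hasSum_norm_inner_sq {ι : Type*} (b : HilbertBasis ι ℂ H) (v : H) :
    HasSum (fun i => ‖inner ℂ v (b i)‖ ^ 2) (‖v‖ ^ 2) := by
  have h := b.hasSum_inner_mul_inner v v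
  rw [inner_self_eq_norm_sq_to_K] at h
  have h2 := Complex.hasSum_re h
  have h3 : ∀ i, (inner ℂ v (b i) * inner ℂ (b i) v).re = ‖inner ℂ v (b i)‖ ^ 2 := by
    intro i
    rw [← inner_conj_symm (b i) v, Complex.mul_conj', ← Complex.ofReal_pow, Complex.ofReal_re]
  simp only [h3] at h2
  simpa [← Complex.ofReal_pow] using h2

/-- The eigenvalues of an average of unit pure states sum to `1`. -/
theorem hasSum_eigenvalues_integral_pureState [CompleteSpace H] [IsProbabilityMeasure μ]
    (hi : Integrable (fun x => pureState (f x)) μ) (hf : ∀ x, ‖f x‖ = 1)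
    {ι : Type*} [Countable ι] (b : HilbertBasis ι ℂ H) {lam : ι → ℝ}
    (h : ∀ i, (∫ x, pureState (f x) ∂μ) (b i) = (lam i : ℂ) • b i) : HasSum lam 1 := by
  have hl : ∀ i, lam i = ∫ x, ‖inner ℂ (f x) (b i)‖ ^ 2 ∂μ :=
    fun i => eigenvalue_integral_pureState hi (b.orthonormal.1 i) (h i)
  have h0 : ∀ i, 0 ≤ lam i := fun i => by
    rw [hl]
    positivity
  -- In `[0, ∞]` the sum over the basis and the integral commute with no prior summability; Parseval
  -- then makes the integrand `‖f x‖ ^ 2 = 1`.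
  have hsum : ∑' i, ENNReal.ofReal (lam i) = 1 := by
    have e : ∀ i, ENNReal.ofReal (lam i) =
        ∫⁻ x, ENNReal.ofReal (‖inner ℂ (f x) (b i)‖ ^ 2) ∂μ := by
      intro i
      rw [hl, ofReal_integral_eq_lintegral_ofReal (integrable_norm_inner_sq hi _)
        (Filter.Eventually.of_forall fun x => by positivity)]
    simp only [e]
    rw [← lintegral_tsum fun i => (integrable_norm_inner_sq hi _).aemeasurable.ennreal_ofReal]
    have e2 : ∀ x, ∑' i, ENNReal.ofReal (‖inner ℂ (f x) (b i)‖ ^ 2) = 1 := by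
      intro x
      have hs := b.hasSum_norm_inner_sq (f x)
      rw [← ENNReal.ofReal_tsum_of_nonneg (fun i => by positivity) hs.summable, hs.tsum_eq, hf]
      simp
    simp only [e2, lintegral_const, measure_univ, mul_one]
  have hs : Summable lam := by
    have := ENNReal.summable_toReal (f := fun i => ENNReal.ofReal (lam i)) (by simp [hsum])
    simpa [ENNReal.toReal_ofReal, h0] using this
  have ht : ENNReal.ofReal (∑' i, lam i) = 1 := by
    rw [ENNReal.ofReal_tsum_of_nonneg h0 hs, hsum]
  rw [ENNReal.ofReal_eq_one] at ht
  rw [← ht]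
  exact hs.hasSum

end SpectralEntropy

/-! ### Entropy of probability vectors with bounded largest entry. -/

section EntropyBounds

variable {ι : Type*} {lam : ι → ℝ}

/-- The entropy may be infinite, so lower bounds go through a termwise minorant `g` with a known
finite sum. -/
theorem ofReal_div_le_tsum_entropyTerm {g : ι → ℝ} {G : ℝ} (h0 : ∀ i, 0 ≤ g i)
    (hg : ∀ i, g i ≤ Real.negMulLog (lam i)) (hG : HasSum g G) :
    ENNReal.ofReal (G / Real.log 2) ≤ ∑' i, entropyTerm (lam i) := by
  have h2 : 0 < Real.log 2 := Real.log_pos (by norm_num)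
  have hG2 := hG.div_const (Real.log 2)
  rw [← hG2.tsum_eq, ENNReal.ofReal_tsum_of_nonneg (fun i => div_nonneg (h0 i) h2.le)
    hG2.summable]
  refine ENNReal.tsum_le_tsum fun i => ENNReal.ofReal_le_ofReal ?_
  gcongr
  exact hg i

theorem mul_neg_log_le_negMulLog {x y : ℝ} (hx : 0 ≤ x) (hxy : x ≤ y) :
    x * -Real.log y ≤ Real.negMulLog x := by
  rcases hx.eq_or_lt with rfl | hx
  · simp
  · rw [Real.negMulLog, neg_mul, mul_neg, neg_le_neg_iff]
    gcongr

/-- If a probability vector has all entries at most `M ≥ 1/2`, then its entropy is at least that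
of `(M, 1 - M)`. -/
theorem binEntropy_le_tsum_entropyTerm {M : ℝ} (hM : 1 / 2 ≤ M) (hM1 : M ≤ 1)
    (h0 : ∀ i, 0 ≤ lam i) (hle : ∀ i, lam i ≤ M) (hs : HasSum lam 1) :
    ENNReal.ofReal (Real.binEntropy M / Real.log 2) ≤ ∑' i, entropyTerm (lam i) := by
  classical
  rcases hM1.eq_or_lt with rfl | hM1
  · simp
  -- Either some entry lies in `[1 - M, M]`, where the binary entropy is at least its value at `M`,
  -- or all entries are below `1 - M` and each `-log (lam i)` is already large.
  by_cases hex : ∃ i, 1 - M ≤ lam i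
  · obtain ⟨j, hj⟩ := hex
    have hj1 : 0 < 1 - lam j := by linarith [hle j]
    have hrest : HasSum (Function.update lam j 0) (1 - lam j) := by
      have := hs.update j 0
      simpa [sub_eq_add_neg, add_comm] using this
    have hrle : ∀ i, i ≠ j → lam i ≤ 1 - lam j := by
      intro i hij
      have := le_hasSum hrest i fun k _ => by
        rcases eq_or_ne k j with rfl | hk
        · simp
        · simp [hk, h0]
      simpa [hij] using this
    -- Binary entropy is symmetric about `1/2`, increasing before it and decreasing after it.
    have hbin : Real.binEntropy M ≤ Real.binEntropy (lam j) := by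
      rcases le_total (1 / 2) (lam j) with h | h
      · refine Real.binEntropy_strictAntiOn.antitoneOn ⟨by norm_num at h ⊢; exact h, ?_⟩
          ⟨by norm_num at hM ⊢; exact hM, hM1.le⟩ (hle j)
        linarith
      · rw [← Real.binEntropy_one_sub M]
        refine Real.binEntropy_strictMonoOn.monotoneOn ⟨by linarith, by norm_num; linarith⟩
          ⟨h0 j, by norm_num at h ⊢; exact h⟩ hj
    refine le_trans (ENNReal.ofReal_le_ofReal (div_le_div_of_nonneg_right hbin
      (Real.log_nonneg (by norm_num)))) ?_
    have hlog : Real.log (1 - lam j) ≤ 0 := Real.log_nonpos hj1.le (by linarith [h0 j])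
    -- The minorant keeps the entry `j` and weights every other `lam i` by `-log (1 - lam j)`, as if
    -- the rest were merged into one entry; it sums to `binEntropy (lam j)`.
    refine ofReal_div_le_tsum_entropyTerm
      (g := Function.update (fun i => lam i * -Real.log (1 - lam j)) j (Real.negMulLog (lam j)))
      ?_ ?_ ?_
    · intro i
      rcases eq_or_ne i j with rfl | hij
      · simpa using Real.negMulLog_nonneg (h0 i) (by linarith)
      · simpa [hij] using mul_nonneg (h0 i) (neg_nonneg.2 hlog)
    · intro i
      rcases eq_or_ne i j with rfl | hij
      · simp
      · simpa [hij] using mul_neg_log_le_negMulLog (h0 i) (hrle i hij)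
    · have := (hs.mul_right (-Real.log (1 - lam j))).update j (Real.negMulLog (lam j))
      have e : Real.binEntropy (lam j) = Real.negMulLog (lam j) -
          lam j * -Real.log (1 - lam j) + 1 * -Real.log (1 - lam j) := by
        rw [Real.binEntropy_eq_negMulLog_add_negMulLog_one_sub, Real.negMulLog, Real.negMulLog]
        ring
      rwa [e]
  · push Not at hex
    have hpos : 0 < 1 - M := by linarith
    have hlogM : Real.log (1 - M) ≤ Real.log M := Real.log_le_log hpos (by linarith)
    have hlog : Real.log (1 - M) ≤ 0 := Real.log_nonpos hpos.le (by linarith)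
    -- `binEntropy M` is a convex combination of `-log M` and `-log (1 - M)`, the second being the
    -- larger.
    have hbin : Real.binEntropy M ≤ -Real.log (1 - M) := by
      rw [Real.binEntropy_eq_negMulLog_add_negMulLog_one_sub, Real.negMulLog, Real.negMulLog]
      nlinarith
    refine le_trans (ENNReal.ofReal_le_ofReal (div_le_div_of_nonneg_right hbin
      (Real.log_nonneg (by norm_num)))) ?_
    refine ofReal_div_le_tsum_entropyTerm (g := fun i => lam i * -Real.log (1 - M))
      (fun i => mul_nonneg (h0 i) (neg_nonneg.2 hlog))
      (fun i => mul_neg_log_le_negMulLog (h0 i) (hex i).le) ?_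
    simpa using hs.mul_right (-Real.log (1 - M))

/-- A finite probability vector with entries in `{0, M, 1 - M}` and the second moment of
`(M, 1 - M)` has the entropy of `(M, 1 - M)`. -/
theorem tsum_entropyTerm_eq_binEntropy [Fintype ι] {M : ℝ} (hM : 1 / 2 ≤ M) (hM1 : M ≤ 1)
    (hval : ∀ i, lam i = 0 ∨ lam i = M ∨ lam i = 1 - M) (hs : ∑ i, lam i = 1)
    (hs2 : ∑ i, lam i ^ 2 = M ^ 2 + (1 - M) ^ 2) :
    ∑' i, entropyTerm (lam i) = ENNReal.ofReal (Real.binEntropy M / Real.log 2) := by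
  -- A quadratic vanishing at `0` interpolates `negMulLog` on `{0, M, 1 - M}`, so the entropy
  -- depends only on the first two moments and multiplicities need not be counted. If `M = 1 - M`, a
  -- linear function suffices.
  obtain ⟨α, β, hα, hβ⟩ : ∃ α β : ℝ, Real.negMulLog M = α * M + β * M ^ 2 ∧
      Real.negMulLog (1 - M) = α * (1 - M) + β * (1 - M) ^ 2 := by
    rcases eq_or_ne M (1 - M) with h | h
    · refine ⟨-Real.log M, 0, ?_, ?_⟩ <;> rw [Real.negMulLog]
      · ring
      · rw [← h]
        ring
    · have h' : M - (1 - M) ≠ 0 := sub_ne_zero.2 h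
      refine ⟨-Real.log M - (Real.log (1 - M) - Real.log M) / (M - (1 - M)) * M,
        (Real.log (1 - M) - Real.log M) / (M - (1 - M)), ?_, ?_⟩ <;> rw [Real.negMulLog]
      · ring
      · field_simp
        ring
  have hterm : ∀ i, Real.negMulLog (lam i) = α * lam i + β * lam i ^ 2 := by
    intro i
    rcases hval i with h | h | h <;> rw [h]
    · simp
    · exact hα
    · exact hβ
  have hnn : ∀ i, 0 ≤ Real.negMulLog (lam i) := by
    intro i
    rcases hval i with h | h | h <;> rw [h] <;> apply Real.negMulLog_nonneg <;> linarith
  rw [tsum_fintype]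
  simp only [entropyTerm]
  rw [← ENNReal.ofReal_sum_of_nonneg fun i _ =>
    div_nonneg (hnn i) (Real.log_nonneg (by norm_num)), ← Finset.sum_div]
  simp only [hterm, Finset.sum_add_distrib, ← Finset.mul_sum, hs, hs2]
  rw [Real.binEntropy_eq_negMulLog_add_negMulLog_one_sub, hα, hβ]
  congr 2
  ring

end EntropyBounds

/-! ### Overlap bound for states measured by one instrument. -/

section Overlap

variable {A H : Type*} [NormedAddCommGroup H] [InnerProductSpace ℂ H]

/-- Polarization of the completeness relation. -/
theorem QuantumInstrument.hasSum_inner (M : QuantumInstrument A H) (φ ψ : H) :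
    HasSum (fun k : A × M.ι => inner ℂ (M.kraus k.1 k.2 φ) (M.kraus k.1 k.2 ψ)) (inner ℂ φ ψ) := by
  have h : ∀ χ : H, HasSum (fun k : A × M.ι => (‖M.kraus k.1 k.2 χ‖ : ℂ) ^ 2) ((‖χ‖ : ℂ) ^ 2) := by
    intro χ
    exact_mod_cast Complex.hasSum_ofReal.2 (M.complete χ)
  have h4 := (((h (φ + ψ)).sub (h (φ - ψ))).add
    (((h (φ - Complex.I • ψ)).sub (h (φ + Complex.I • ψ))).mul_right Complex.I)).div_const 4
  have e : (fun k : A × M.ι => inner ℂ (M.kraus k.1 k.2 φ) (M.kraus k.1 k.2 ψ)) = _ :=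
    funext fun k => inner_eq_sum_norm_sq_div_four _ _
  rw [inner_eq_sum_norm_sq_div_four, e]
  simp only [map_add, map_sub, map_smul] at h4
  exact h4

theorem QuantumInstrument.kraus_eq_zero {M : QuantumInstrument A H} {φ : H} {a : A}
    (h : M.OutcomeProb φ a 0) (k : M.ι) : M.kraus a k φ = 0 := by
  have := (hasSum_zero_iff_of_nonneg fun i => by positivity).1 h
  simpa using congrFun this k

/-- If `a` is the only outcome that two states have in common, then their overlap is at most the
geometric mean of the two probabilities of `a`. -/
theorem QuantumInstrument.norm_inner_le (M : QuantumInstrument A H) {φ ψ : H} {a : A} {r s : ℝ}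
    (hφ : M.OutcomeProb φ a r) (hψ : M.OutcomeProb ψ a s)
    (hdis : ∀ b, b ≠ a → M.OutcomeProb φ b 0 ∨ M.OutcomeProb ψ b 0) :
    ‖inner ℂ φ ψ‖ ≤ Real.sqrt (r * s) := by
  have hr : 0 ≤ r := hφ.nonneg fun i => by positivity
  have hs : 0 ≤ s := hψ.nonneg fun i => by positivity
  have hinj : Function.Injective fun k : M.ι => (a, k) := fun k l h => (Prod.mk.inj h).2
  -- For an outcome other than `a`, one of the two Kraus images vanishes, so only the branches of
  -- `a` remain; Cauchy–Schwarz for series finishes.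
  have hsum : HasSum (fun k => inner ℂ (M.kraus a k φ) (M.kraus a k ψ)) (inner ℂ φ ψ) := by
    refine (hinj.hasSum_iff ?_).2 (M.hasSum_inner φ ψ)
    rintro ⟨b, k⟩ hbk
    have hb : b ≠ a := by
      rintro rfl
      exact hbk ⟨k, rfl⟩
    rcases hdis b hb with h | h
    · simp [QuantumInstrument.kraus_eq_zero h]
    · simp [QuantumInstrument.kraus_eq_zero h]
  obtain ⟨C, -, hC, hCsum⟩ := Real.inner_le_Lp_mul_Lq_hasSum_of_nonneg
    Real.HolderConjugate.two_two (Real.sqrt_nonneg r) (Real.sqrt_nonneg s)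
    (f := fun k => ‖M.kraus a k φ‖) (g := fun k => ‖M.kraus a k ψ‖)
    (fun k => norm_nonneg _) (fun k => norm_nonneg _)
    (by simpa [Real.sq_sqrt hr, QuantumInstrument.OutcomeProb] using hφ)
    (by simpa [Real.sq_sqrt hs, QuantumInstrument.OutcomeProb] using hψ)
  rw [Real.sqrt_mul hr]
  exact (hsum.norm_le_of_bounded hCsum fun k => norm_inner_le_norm _ _).trans hC

end Overlap

/-! ### From small overlaps to a bound on the largest eigenvalue. -/

section EigenvalueBound

/-- Cauchy–Schwarz against the constant function, by expanding the nonnegative integral of `(μ(X) g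
- ∫ g)²`. -/
theorem sq_integral_le {X : Type*} [MeasurableSpace X] {μ : Measure X} [IsFiniteMeasure μ]
    {g : X → ℝ} (hg : Integrable g μ) (hg2 : Integrable (fun x => g x ^ 2) μ) :
    (∫ x, g x ∂μ) ^ 2 ≤ μ.real Set.univ * ∫ x, g x ^ 2 ∂μ := by
  rcases (measureReal_nonneg (μ := μ) (s := Set.univ)).eq_or_lt with h0 | h0
  · have : μ = 0 := by
      rw [eq_comm, measureReal_eq_zero_iff] at h0
      exact Measure.measure_univ_eq_zero.1 h0
    simp [this]
  · have h : 0 ≤ ∫ x, (μ.real Set.univ * g x - ∫ x, g x ∂μ) ^ 2 ∂μ :=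
      integral_nonneg fun x => sq_nonneg _
    have e : ∀ x, (μ.real Set.univ * g x - ∫ x, g x ∂μ) ^ 2 =
        μ.real Set.univ ^ 2 * g x ^ 2 + ((∫ x, g x ∂μ) ^ 2 -
          (2 * μ.real Set.univ * ∫ x, g x ∂μ) * g x) := fun x => by ring
    have h1 : Integrable (fun x => (∫ x, g x ∂μ) ^ 2 -
        (2 * μ.real Set.univ * ∫ x, g x ∂μ) * g x) μ := (integrable_const _).sub (hg.const_mul _)
    simp only [e] at h
    rw [integral_add (hg2.const_mul _) h1,
      integral_sub (integrable_const _) (hg.const_mul _), integral_const_mul, integral_const_mul,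
      integral_const, smul_eq_mul] at h
    by_contra! hlt
    nlinarith [mul_lt_mul_of_pos_left hlt h0]

theorem le_of_sq_le_quadratic {l a b m n c M α β : ℝ} (hα : 0 ≤ α) (hβ : 0 ≤ β)
    (ham : a ^ 2 ≤ m * α) (hbn : b ^ 2 ≤ n * β) (hl : l = α + β)
    (hm : m ≤ M) (hnM : n ≤ M) (hM0 : 0 ≤ M)
    (hM : (M - m) * (M - n) = m * n * c ^ 2) (h : l ^ 2 ≤ a ^ 2 + b ^ 2 + 2 * c * (a * b)) :
    l ≤ M := by
  have hab : (a * b) ^ 2 ≤ m * α * (n * β) := by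
    rw [mul_pow]
    exact mul_le_mul ham hbn (sq_nonneg _) ((sq_nonneg _).trans ham)
  -- AM–GM: the square of the left side is at most `4 m n c² α β`, which by `hM` equals `4 (M - m) α
  -- (M - n) β`. Adding `a² ≤ m α` and `b² ≤ n β` then gives `l² ≤ M l`.
  have hcross : 2 * c * (a * b) ≤ (M - m) * α + (M - n) * β := by
    refine abs_le_of_sq_le_sq' ?_ ?_ |>.2
    · nlinarith [mul_le_mul_of_nonneg_left hab (sq_nonneg c),
        sq_nonneg ((M - m) * α - (M - n) * β), congrArg (· * (α * β)) hM]
    · have := mul_nonneg (sub_nonneg.2 hm) hα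
      have := mul_nonneg (sub_nonneg.2 hnM) hβ
      linarith
  have h2 : l ^ 2 ≤ M * l := by
    rw [hl] at h ⊢
    linarith
  rcases (add_nonneg hα hβ).eq_or_lt with h0 | h0
  · rw [hl, ← h0]
    exact hM0
  · rw [← hl] at h0
    nlinarith

variable {H : Type*} [NormedAddCommGroup H] [InnerProductSpace ℂ H]

theorem norm_pureState_apply {ψ : H} (hψ : ‖ψ‖ = 1) (v : H) :
    ‖pureState ψ v‖ = ‖inner ℂ ψ v‖ := by
  rw [pureState_apply, norm_smul, hψ, mul_one]

variable [CompleteSpace H] {X : Type*} [MeasurableSpace X] {μ : Measure X} {f : X → H}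

/-- If the overlap of `f x` and `f y` is at most `c` for `x ∈ S` and `y ∉ S`, then the eigenvalues
of the average of the states `f x` are at most the larger root `M` of the characteristic
polynomial of the Gram matrix of two states with overlap `c`. -/
theorem eigenvalue_integral_pureState_le [IsFiniteMeasure μ]
    (hi : Integrable (fun x => pureState (f x)) μ) (hf : ∀ x, ‖f x‖ = 1) {S : Set X}
    (hS : MeasurableSet S) {c M : ℝ}
    (hov : ∀ᵐ x ∂μ, ∀ᵐ y ∂μ, x ∈ S → y ∉ S → ‖inner ℂ (f x) (f y)‖ ≤ c)
    (hm : μ.real S ≤ M) (hn : μ.real Sᶜ ≤ M)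
    (hM : (M - μ.real S) * (M - μ.real Sᶜ) = μ.real S * μ.real Sᶜ * c ^ 2)
    {v : H} (hv : ‖v‖ = 1) {l : ℝ} (h : (∫ x, pureState (f x) ∂μ) v = (l : ℂ) • v) : l ≤ M := by
  have hl := eigenvalue_integral_pureState hi hv h
  have hiv : Integrable (fun x => pureState (f x) v) μ := hi.apply_continuousLinearMap v
  have hg : Integrable (fun x => ‖inner ℂ (f x) v‖) μ := by
    simpa only [norm_pureState_apply (hf _)] using hiv.norm
  have hg2 := integrable_norm_inner_sq hi v
  -- The eigenvalue equation splits as `l v = a + b` over `S` and its complement. Expanding `‖a +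
  -- b‖²` reduces the claim to `le_of_sq_le_quadratic`, with the overlap bound entering only through
  -- the cross term.
  set a : H := ∫ x in S, pureState (f x) v ∂μ with ha
  set b : H := ∫ x in Sᶜ, pureState (f x) v ∂μ with hb
  have hab : a + b = (l : ℂ) • v := by
    rw [← h, ContinuousLinearMap.integral_apply hi]
    exact integral_add_compl hS hiv
  have hna : ‖a‖ ≤ ∫ x in S, ‖inner ℂ (f x) v‖ ∂μ := by
    refine (norm_integral_le_integral_norm _).trans_eq ?_
    simp only [norm_pureState_apply (hf _)]
  have hnb : ‖b‖ ≤ ∫ x in Sᶜ, ‖inner ℂ (f x) v‖ ∂μ := by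
    refine (norm_integral_le_integral_norm _).trans_eq ?_
    simp only [norm_pureState_apply (hf _)]
  have hin : ‖inner ℂ b a‖ ≤
      c * ((∫ x in S, ‖inner ℂ (f x) v‖ ∂μ) * ∫ x in Sᶜ, ‖inner ℂ (f x) v‖ ∂μ) := by
    -- The inner product of `b` and `a` is a double integral over `Sᶜ` and `S`; this bounds its
    -- inner integral for fixed `x`.
    have hx : ∀ᵐ x ∂μ.restrict S, ‖inner ℂ b (pureState (f x) v)‖ ≤
        c * (‖inner ℂ (f x) v‖ * ∫ y in Sᶜ, ‖inner ℂ (f y) v‖ ∂μ) := by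
      filter_upwards [ae_restrict_of_ae hov, ae_restrict_mem hS] with x hx hxS
      rw [norm_inner_symm, hb, ← integral_inner hiv.integrableOn]
      rw [← integral_const_mul, ← integral_const_mul]
      refine norm_integral_le_of_norm_le ((hg.integrableOn.const_mul _).const_mul _) ?_
      filter_upwards [ae_restrict_of_ae hx, ae_restrict_mem hS.compl] with y hy hyS
      rw [pureState_apply, pureState_apply, inner_smul_left, inner_smul_right, norm_mul, norm_mul,
        RCLike.norm_conj]
      have := mul_le_mul_of_nonneg_left (hy hxS hyS)
        (mul_nonneg (norm_nonneg (inner ℂ (f x) v)) (norm_nonneg (inner ℂ (f y) v)))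
      linarith
    rw [ha, ← integral_inner hiv.integrableOn, ← integral_mul_const, ← integral_const_mul]
    exact norm_integral_le_of_norm_le ((hg.integrableOn.mul_const _).const_mul _) hx
  have hsq : l ^ 2 ≤ (∫ x in S, ‖inner ℂ (f x) v‖ ∂μ) ^ 2 +
      (∫ x in Sᶜ, ‖inner ℂ (f x) v‖ ∂μ) ^ 2 +
      2 * c * ((∫ x in S, ‖inner ℂ (f x) v‖ ∂μ) * ∫ x in Sᶜ, ‖inner ℂ (f x) v‖ ∂μ) := by
    have e : l ^ 2 = ‖b + a‖ ^ 2 := by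
      rw [add_comm, hab, norm_smul, hv, mul_one, Complex.norm_real, Real.norm_eq_abs, sq_abs]
    rw [e, @norm_add_sq ℂ]
    have := (RCLike.re_le_norm (inner ℂ b a)).trans hin
    have := pow_le_pow_left₀ (norm_nonneg _) hna 2
    have := pow_le_pow_left₀ (norm_nonneg _) hnb 2
    linarith
  have ham := sq_integral_le (hg.integrableOn (s := S)) (hg2.integrableOn (s := S))
  have hbn := sq_integral_le (hg.integrableOn (s := Sᶜ)) (hg2.integrableOn (s := Sᶜ))
  rw [measureReal_restrict_apply_univ] at ham hbn
  refine le_of_sq_le_quadratic (integral_nonneg fun x => sq_nonneg _)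
    (integral_nonneg fun x => sq_nonneg _) ham hbn ?_ hm hn
    (measureReal_nonneg.trans hm) hM hsq
  rw [hl]
  exact (integral_add_compl hS hg2).symm

end EigenvalueBound

/-! ### Cylinder sets generate the σ-algebra of pasts. -/

section Cylinders

/-- The set of pasts whose last outputs, read backwards in time, are `w`. -/
def pastCylinder {A : Type*} (w : List A) : Set (ℕ → A) :=
  {x | ∀ j (hj : j < w.length), x j = w[j]}

variable {A : Type*}

/-- Two cylinders that meet are nested, the longer word giving the smaller set. Words are nonempty
so that the most recent symbol, hence the machine state, is constant on each cylinder. -/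
theorem isPiSystem_pastCylinder :
    IsPiSystem {s : Set (ℕ → A) | ∃ b w, s = pastCylinder (b :: w)} := by
  have key : ∀ v w : List A, v.length ≤ w.length → (pastCylinder v ∩ pastCylinder w).Nonempty →
      pastCylinder v ∩ pastCylinder w = pastCylinder w := by
    rintro v w hvw ⟨x, hxv, hxw⟩
    refine Set.inter_eq_right.2 fun y hy j hj => ?_
    rw [hy j (hj.trans_le hvw), ← hxw j (hj.trans_le hvw), hxv j hj]
  rintro _ ⟨b, v, rfl⟩ _ ⟨c, w, rfl⟩ hne
  rcases le_total (b :: v).length (c :: w).length with h | h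
  · exact ⟨c, w, key _ _ h hne⟩
  · rw [Set.inter_comm] at hne ⊢
    exact ⟨b, v, key _ _ h hne⟩

variable [MeasurableSpace A]

theorem measurable_pastOf : Measurable (pastOf : (ℤ → A) → ℕ → A) :=
  measurable_pi_lambda _ fun _ => measurable_pi_apply _

variable [MeasurableSingletonClass A]

theorem measurableSet_pastCylinder (w : List A) : MeasurableSet (pastCylinder w) := by
  simp only [pastCylinder, Set.ofPred_forall]
  exact MeasurableSet.iInter fun j => MeasurableSet.iInter fun hj =>
    measurable_pi_apply j (measurableSet_singleton _)

theorem generateFrom_pastCylinder [Countable A] :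
    (MeasurableSpace.pi : MeasurableSpace (ℕ → A)) =
      MeasurableSpace.generateFrom {s | ∃ b w, s = pastCylinder (b :: w)} := by
  refine le_antisymm ?_ (MeasurableSpace.generateFrom_le ?_)
  · refine iSup_le fun i => ?_
    rw [← measurable_iff_comap_le]
    refine @measurable_to_countable' _ _ _ _ (MeasurableSpace.generateFrom _) _ fun a => ?_
    -- Fixing coordinate `i` is a countable union over the words of length `i + 1` that carry `a`
    -- there.
    have e : (fun x : ℕ → A => x i) ⁻¹' {a} =
        ⋃ u : {w : List A // w.length = i + 1 ∧ w[i]? = some a}, pastCylinder u.1 := by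
      ext x
      simp only [Set.mem_preimage, Set.mem_singleton_iff, Set.mem_iUnion]
      constructor
      · intro hx
        exact ⟨⟨(List.range (i + 1)).map x, by simp, by simp [hx]⟩, fun j hj => by simp⟩
      · rintro ⟨⟨w, hw, hwa⟩, hx⟩
        rw [hx i (by simp only; omega)]
        exact (List.getElem?_eq_some_iff.1 hwa).2
    rw [e]
    refine MeasurableSet.iUnion fun u => MeasurableSpace.measurableSet_generateFrom ?_
    obtain ⟨b, w, h⟩ := List.exists_cons_of_length_eq_add_one u.2.1
    exact ⟨b, w, by rw [h]⟩
  · rintro _ ⟨b, w, rfl⟩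
    exact measurableSet_pastCylinder _

/-- Finite measures on the pasts over a finite alphabet that agree on cylinders are equal. -/
theorem ext_of_pastCylinder [Countable A] [Nonempty A] {μ ν : Measure (ℕ → A)} [IsFiniteMeasure μ]
    (h : ∀ b w, μ (pastCylinder (b :: w)) = ν (pastCylinder (b :: w))) : μ = ν := by
  obtain ⟨g, hg⟩ := exists_surjective_nat A
  refine Measure.ext_of_generateFrom_of_iUnion _ (fun n => pastCylinder [g n])
    generateFrom_pastCylinder isPiSystem_pastCylinder ?_ (fun n => ⟨g n, [], rfl⟩)
    (fun n => measure_ne_top _ _) ?_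
  · refine Set.eq_univ_of_forall fun x => ?_
    obtain ⟨n, hn⟩ := hg (x 0)
    refine Set.mem_iUnion.2 ⟨n, fun j hj => ?_⟩
    have : j = 0 := by simpa using hj
    subst this
    exact hn.symm
  · rintro _ ⟨b, w, rfl⟩
    exact h b w

end Cylinders

/-! ### Conditional law of the next output given the past. -/

namespace HeraldingCoin

variable {p q : ℝ}

/-- The state of the machine after the output `a`. -/
def nextState (a : Fin 3) : Fin 2 := if a = 1 then 1 else 0

/-- The probability that the machine emits `a` in the state `i`. -/
def outProb (p q : ℝ) (i : Fin 2) (a : Fin 3) : ℝ := ∑ j, transProb p q i a j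

theorem transProb_eq_zero {a : Fin 3} {j : Fin 2} (h : j ≠ nextState a) (i : Fin 2) :
    transProb p q i a j = 0 := by
  fin_cases i <;> fin_cases a <;> fin_cases j <;> first | rfl | exact absurd rfl h

theorem transProb_nonneg (hp : p ∈ Set.Icc (0 : ℝ) 1) (hq : q ∈ Set.Icc (0 : ℝ) 1) (i : Fin 2)
    (a : Fin 3) (j : Fin 2) : 0 ≤ transProb p q i a j := by
  have := hp.1
  have := hp.2
  have := hq.1
  have := hq.2
  fin_cases i <;> fin_cases a <;> fin_cases j <;> simp [transProb] <;> linarith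

theorem outProb_nonneg (hp : p ∈ Set.Icc (0 : ℝ) 1) (hq : q ∈ Set.Icc (0 : ℝ) 1) (i : Fin 2)
    (a : Fin 3) : 0 ≤ outProb p q i a :=
  Finset.sum_nonneg fun j _ => transProb_nonneg hp hq i a j

/-- After the output `b` the machine is in `nextState b` wherever it started, so the last factor
does not depend on `i`. -/
theorem wordProb_append_pair (i : Fin 2) (w : List (Fin 3)) (b a : Fin 3) :
    wordProb p q i (w ++ [b, a]) = wordProb p q i (w ++ [b]) * outProb p q (nextState b) a := by
  induction w generalizing i with
  | nil =>
    simp only [List.nil_append, wordProb, mul_one, Finset.sum_mul, outProb]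
    refine Finset.sum_congr rfl fun j _ => ?_
    by_cases h : j = nextState b
    · rw [h]
    · rw [transProb_eq_zero h, zero_mul, zero_mul]
  | cons x w ih =>
    simp only [List.cons_append, wordProb, ih, Finset.sum_mul, mul_assoc]

variable {P : Measure (ℤ → Fin 3)}

theorem IsLaw.measure_backward (hP : IsLaw p q P) (s : ℤ) (w : List (Fin 3)) :
    P {ω | ∀ j (hj : j < w.length), ω (s - (j : ℕ)) = w[j]} =
      ENNReal.ofReal (∑ i, statProb p q i * wordProb p q i w.reverse) := by
  -- Read forwards, the reversed word occupies the times `s - w.length + 1` to `s`.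
  rw [← hP (s - w.length + 1) w.reverse]
  congr 1
  ext ω
  simp only [Set.mem_ofPred_eq, List.get_eq_getElem, List.getElem_reverse]
  constructor
  · rintro h ⟨k, hk⟩
    rw [List.length_reverse] at hk
    rw [← h (w.length - 1 - k) (by omega)]
    congr 1
    simp only
    omega
  · intro h j hj
    have h2 := h ⟨w.length - 1 - j, by rw [List.length_reverse]; omega⟩
    have e : w.length - 1 - (w.length - 1 - j) = j := by omega
    simp only [e] at h2
    rw [← h2]
    congr 1
    omega

theorem IsLaw.pastLaw_pastCylinder (hP : IsLaw p q P) (w : List (Fin 3)) :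
    pastLaw P (pastCylinder w) =
      ENNReal.ofReal (∑ i, statProb p q i * wordProb p q i w.reverse) := by
  rw [pastLaw, Measure.map_apply measurable_pastOf (measurableSet_pastCylinder w),
    ← hP.measure_backward (-1) w]
  congr 1
  ext ω
  simp only [pastCylinder, pastOf, Set.mem_preimage, Set.mem_ofPred_eq, neg_add_rev]
  rfl

/-- The event that the present output is `a` and the past starts with `w` is a single backward word
`a :: w` from time `0`. -/
theorem IsLaw.map_restrict_pastCylinder (hP : IsLaw p q P) (a : Fin 3) (w : List (Fin 3)) :
    (P.restrict ((fun ω : ℤ → Fin 3 => ω 0) ⁻¹' {a})).map pastOf (pastCylinder w) =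
      ENNReal.ofReal (∑ i, statProb p q i * wordProb p q i (a :: w).reverse) := by
  rw [Measure.map_apply measurable_pastOf (measurableSet_pastCylinder w),
    Measure.restrict_apply (measurable_pastOf (measurableSet_pastCylinder w)),
    ← hP.measure_backward 0 (a :: w)]
  congr 1
  ext ω
  simp only [pastCylinder, pastOf, Set.mem_inter_iff, Set.mem_preimage, Set.mem_ofPred_eq,
    Set.mem_singleton_iff]
  constructor
  · rintro ⟨h, h0⟩ j hj
    cases j with
    | zero => simpa using h0
    | succ k =>
      rw [List.getElem_cons_succ, ← h k (by simpa using hj)]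
      congr 1
  · intro h
    refine ⟨fun j hj => ?_, h 0 (by simp)⟩
    have h2 := h (j + 1) (by simpa using hj)
    rw [List.getElem_cons_succ] at h2
    rw [← h2]
    congr 1

/-- On the cylinder of `b :: w` the density is constant, and the factorization of word probabilities
gives equality there; cylinders determine the measures. -/
theorem IsLaw.map_restrict_eq_withDensity [IsProbabilityMeasure P] (hP : IsLaw p q P)
    (hp : p ∈ Set.Icc (0 : ℝ) 1) (hq : q ∈ Set.Icc (0 : ℝ) 1) (a : Fin 3) :
    (P.restrict ((fun ω : ℤ → Fin 3 => ω 0) ⁻¹' {a})).map pastOf =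
      (pastLaw P).withDensity fun x => ENNReal.ofReal (outProb p q (nextState (x 0)) a) := by
  refine ext_of_pastCylinder fun b w => ?_
  rw [hP.map_restrict_pastCylinder, withDensity_apply _ (measurableSet_pastCylinder _)]
  have e : ∫⁻ x in pastCylinder (b :: w), ENNReal.ofReal (outProb p q (nextState (x 0)) a)
      ∂(pastLaw P) = ∫⁻ x in pastCylinder (b :: w), ENNReal.ofReal (outProb p q (nextState b) a)
      ∂(pastLaw P) := by
    refine setLIntegral_congr_fun (measurableSet_pastCylinder _) fun x hx => ?_
    have h0 : x 0 = b := hx 0 (by simp)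
    simp only [h0]
  rw [e, setLIntegral_const, hP.pastLaw_pastCylinder,
    ← ENNReal.ofReal_mul (outProb_nonneg hp hq _ _)]
  congr 1
  simp only [List.reverse_cons, List.append_assoc, List.cons_append, List.nil_append,
    wordProb_append_pair]
  rw [Finset.mul_sum]
  exact Finset.sum_congr rfl fun i _ => by ring

/-- The next output of the heralding coin, given the past, has the distribution of the output of
the machine in the state that the past determines. -/
theorem IsLaw.nextProb_ae_eq [IsProbabilityMeasure P] (hP : IsLaw p q P)
    (hp : p ∈ Set.Icc (0 : ℝ) 1) (hq : q ∈ Set.Icc (0 : ℝ) 1) :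
    ∀ᵐ x ∂(pastLaw P), ∀ a, nextProb P x a = outProb p q (nextState (x 0)) a := by
  have : IsProbabilityMeasure (pastLaw P) :=
    Measure.isProbabilityMeasure_map measurable_pastOf.aemeasurable
  rw [ae_all_iff]
  intro a
  have hmeas : Measurable fun x : ℕ → Fin 3 =>
      ENNReal.ofReal (outProb p q (nextState (x 0)) a) :=
    (Measurable.of_discrete (f := fun b => ENNReal.ofReal (outProb p q (nextState b) a))).comp
      (measurable_pi_apply 0)
  have hmeas2 : Measurable fun x : ℕ → Fin 3 =>
      condDistrib (fun ω : ℤ → Fin 3 => ω 0) pastOf P x {a} :=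
    Kernel.measurable_coe _ (measurableSet_singleton a)
  -- Both functions integrate over every measurable set of pasts to the joint probability with the
  -- output `a`.
  have h : (fun x => condDistrib (fun ω : ℤ → Fin 3 => ω 0) pastOf P x {a}) =ᵐ[pastLaw P]
      fun x => ENNReal.ofReal (outProb p q (nextState (x 0)) a) := by
    refine ae_eq_of_forall_setLIntegral_eq_of_sigmaFinite hmeas2 hmeas fun s hs _ => ?_
    rw [← withDensity_apply (fun x => ENNReal.ofReal (outProb p q (nextState (x 0)) a)) hs,
      ← hP.map_restrict_eq_withDensity hp hq, pastLaw,
      setLIntegral_map hs hmeas2 measurable_pastOf,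
      setLIntegral_preimage_condDistrib measurable_pastOf (measurable_pi_apply 0).aemeasurable
        (measurableSet_singleton a) hs,
      Measure.map_apply measurable_pastOf hs, Measure.restrict_apply (measurable_pastOf hs)]
  filter_upwards [h] with x hx
  rw [nextProb, measureReal_def, hx, ENNReal.toReal_ofReal (outProb_nonneg hp hq _ _)]

/-- The pasts that end in `1`. -/
def endsInOne : Set (ℕ → Fin 3) := {x | x 0 = 1}

theorem measurableSet_endsInOne : MeasurableSet endsInOne :=
  measurable_pi_apply 0 (measurableSet_singleton 1)

theorem statProb_nonneg (hp : p ∈ Set.Icc (0 : ℝ) 1) (hq : q ∈ Set.Icc (0 : ℝ) 1) (i : Fin 2) :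
    0 ≤ statProb p q i := by
  have := hp.1
  have := hq.1
  fin_cases i <;> simp only [statProb] <;> simp <;> positivity

theorem statProb_add (hpq : 0 < p + q) : statProb p q 0 + statProb p q 1 = 1 := by
  simp only [statProb, Matrix.cons_val_zero, Matrix.cons_val_one]
  field_simp
  ring

theorem IsLaw.measureReal_endsInOne (hP : IsLaw p q P) (hp : p ∈ Set.Icc (0 : ℝ) 1)
    (hq : q ∈ Set.Icc (0 : ℝ) 1) (hpq : 0 < p + q) :
    (pastLaw P).real endsInOne = statProb p q 1 := by
  have e : endsInOne = pastCylinder [1] := by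
    ext x
    simp [endsInOne, pastCylinder]
  rw [measureReal_def, e, hP.pastLaw_pastCylinder]
  -- This is the stationarity equation `π₀ p + π₁ (1 - q) = π₁`.
  have e2 : ∑ i, statProb p q i * wordProb p q i [(1 : Fin 3)].reverse = statProb p q 1 := by
    simp [wordProb, Fin.sum_univ_two, transProb, statProb]
    field_simp
    ring
  rw [e2, ENNReal.toReal_ofReal (statProb_nonneg hp hq 1)]

theorem IsLaw.measureReal_endsInOne_compl [IsProbabilityMeasure P] (hP : IsLaw p q P)
    (hp : p ∈ Set.Icc (0 : ℝ) 1) (hq : q ∈ Set.Icc (0 : ℝ) 1) (hpq : 0 < p + q) :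
    (pastLaw P).real endsInOneᶜ = statProb p q 0 := by
  have : IsProbabilityMeasure (pastLaw P) :=
    Measure.isProbabilityMeasure_map measurable_pastOf.aemeasurable
  rw [probReal_compl_eq_one_sub measurableSet_endsInOne, hP.measureReal_endsInOne hp hq hpq]
  linarith [statProb_add hpq]

end HeraldingCoin

/-! ### Spectrum and entropy of a mixture of two pure states. -/

section GramEigenvalue

/-- The larger root of the characteristic polynomial of the Gram matrix of two states with
weights `m + n = 1` and overlap `c`. -/
theorem exists_gram_eigenvalue {m n c : ℝ} (hm : 0 ≤ m) (hn : 0 ≤ n) (hmn : m + n = 1)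
    (hc : c ^ 2 ≤ 1) :
    ∃ M : ℝ, 1 / 2 ≤ M ∧ M ≤ 1 ∧ m ≤ M ∧ n ≤ M ∧ (M - m) * (M - n) = m * n * c ^ 2 := by
  -- Since `m + n = 1`, the equation for `M` reads `M² - M + m n (1 - c²) = 0`. Its discriminant
  -- equals `(m - n)² + 4 m n c²`, which also yields `m ≤ M` and `n ≤ M`.
  have hd : 0 ≤ 1 - 4 * (m * n * (1 - c ^ 2)) := by
    nlinarith [sq_nonneg (m - n), mul_nonneg (mul_nonneg hm hn) (sq_nonneg c)]
  have hs := Real.sq_sqrt hd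
  have hs0 := Real.sqrt_nonneg (1 - 4 * (m * n * (1 - c ^ 2)))
  set s := Real.sqrt (1 - 4 * (m * n * (1 - c ^ 2)))
  have hn' : n = 1 - m := by linarith
  have h2 : (m - n) ^ 2 ≤ s ^ 2 := by
    rw [hs]
    nlinarith [mul_nonneg (mul_nonneg hm hn) (sq_nonneg c)]
  have h3 := abs_le_of_sq_le_sq' h2 hs0
  have h1 : s ≤ 1 := by
    nlinarith [mul_nonneg (mul_nonneg hm hn) (sub_nonneg.2 hc)]
  refine ⟨(1 + s) / 2, by linarith, by linarith, by linarith [h3.2], by linarith [h3.1], ?_⟩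
  rw [hn'] at hs ⊢
  linarith

variable {H : Type*} [NormedAddCommGroup H] [InnerProductSpace ℂ H] {φ ψ v : H} {m n c l : ℝ}

theorem eigenvector_inner_left (hφ : ‖φ‖ = 1) (hc : inner ℂ φ ψ = (c : ℂ))
    (h : (m : ℂ) • pureState φ v + (n : ℂ) • pureState ψ v = (l : ℂ) • v) :
    (l : ℂ) * inner ℂ φ v = m * inner ℂ φ v + n * c * inner ℂ ψ v := by
  have h2 := congrArg (inner ℂ φ) h
  simp only [pureState_apply, inner_add_right, inner_smul_right, hc,
    inner_self_eq_norm_sq_to_K, hφ] at h2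
  rw [← h2]
  simp
  ring

theorem eigenvector_inner_right (hψ : ‖ψ‖ = 1) (hc : inner ℂ φ ψ = (c : ℂ))
    (h : (m : ℂ) • pureState φ v + (n : ℂ) • pureState ψ v = (l : ℂ) • v) :
    (l : ℂ) * inner ℂ ψ v = n * inner ℂ ψ v + m * c * inner ℂ φ v := by
  refine eigenvector_inner_left hψ ?_ (by rw [add_comm, h])
  rw [← inner_conj_symm, hc, Complex.conj_ofReal]

theorem eigenvalue_eq_weighted_sq (hv : ‖v‖ = 1)
    (h : (m : ℂ) • pureState φ v + (n : ℂ) • pureState ψ v = (l : ℂ) • v) :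
    l = m * ‖inner ℂ φ v‖ ^ 2 + n * ‖inner ℂ ψ v‖ ^ 2 := by
  have h2 := congrArg (inner ℂ v) h
  simp only [inner_add_right, inner_smul_right, inner_pureState_apply,
    inner_self_eq_norm_sq_to_K, hv] at h2
  have h3 : ((m * ‖inner ℂ φ v‖ ^ 2 + n * ‖inner ℂ ψ v‖ ^ 2 : ℝ) : ℂ) = (l : ℂ) := by
    push_cast at h2 ⊢
    simpa using h2
  exact_mod_cast h3.symm

/-- The overlaps of `v` with `φ` and `ψ` solve a homogeneous 2×2 system. Unless `l` is a root of its
determinant, both overlaps vanish and `l = 0`; the roots `M` and `1 - M` sum to `m + n = 1`. -/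
theorem eigenvalue_mem {M : ℝ} (hφ : ‖φ‖ = 1) (hψ : ‖ψ‖ = 1) (hv : ‖v‖ = 1) (hmn : m + n = 1)
    (hc : inner ℂ φ ψ = (c : ℂ)) (hM : (M - m) * (M - n) = m * n * c ^ 2)
    (h : (m : ℂ) • pureState φ v + (n : ℂ) • pureState ψ v = (l : ℂ) • v) :
    l = 0 ∨ l = M ∨ l = 1 - M := by
  by_cases hl : l = 0
  · exact Or.inl hl
  right
  have ha := eigenvector_inner_left hφ hc h
  have hb := eigenvector_inner_right hψ hc h
  have hx : (((l - m) * (l - n) - m * n * c ^ 2 : ℝ) : ℂ) * inner ℂ φ v = 0 := by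
    push_cast
    linear_combination ((l : ℂ) - n) * ha + (n * c : ℂ) * hb
  have hy : (((l - m) * (l - n) - m * n * c ^ 2 : ℝ) : ℂ) * inner ℂ ψ v = 0 := by
    push_cast
    linear_combination ((l : ℂ) - m) * hb + (m * c : ℂ) * ha
  have hchar : (l - m) * (l - n) - m * n * c ^ 2 = 0 := by
    by_contra hne
    have hne' := Complex.ofReal_ne_zero.2 hne
    have hx0 := (mul_eq_zero.1 hx).resolve_left hne'
    have hy0 := (mul_eq_zero.1 hy).resolve_left hne'
    have := eigenvalue_eq_weighted_sq hv h
    rw [hx0, hy0] at this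
    simp at this
    exact hl this
  have hprod : (l - M) * (l - (1 - M)) = 0 := by
    linear_combination hchar - hM + (l - M) * hmn
  rcases mul_eq_zero.1 hprod with h | h
  · exact Or.inl (by linarith)
  · exact Or.inr (by linarith)

/-- Summed over an eigenbasis, the right side becomes `m² + n² + 2 m n c²` by Parseval: the second
moment of the spectrum. -/
theorem eigenvalue_sq_eq (hφ : ‖φ‖ = 1) (hψ : ‖ψ‖ = 1) (hv : ‖v‖ = 1)
    (hc : inner ℂ φ ψ = (c : ℂ))
    (h : (m : ℂ) • pureState φ v + (n : ℂ) • pureState ψ v = (l : ℂ) • v) :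
    l ^ 2 = m ^ 2 * ‖inner ℂ φ v‖ ^ 2 + n ^ 2 * ‖inner ℂ ψ v‖ ^ 2 +
      2 * (m * n * c) * (inner ℂ φ v * inner ℂ v ψ).re := by
  have ha := congrArg (fun z : ℂ => (z * inner ℂ v φ).re) (eigenvector_inner_left hφ hc h)
  have hb := congrArg (fun z : ℂ => (z * inner ℂ v ψ).re) (eigenvector_inner_right hψ hc h)
  have hl := eigenvalue_eq_weighted_sq hv h
  simp only [← inner_conj_symm v φ, ← inner_conj_symm v ψ, ← Complex.normSq_eq_norm_sq,
    Complex.normSq_apply, Complex.mul_re, Complex.mul_im, Complex.add_re, Complex.add_im,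
    Complex.ofReal_re, Complex.ofReal_im, Complex.conj_re, Complex.conj_im] at ha hb hl ⊢
  linear_combination l * hl + m * ha + n * hb

/-- The entropy of a mixture of two pure states with real overlap `c`. -/
theorem vonNeumannEntropy_mixture [FiniteDimensional ℂ H] {M : ℝ} (hφ : ‖φ‖ = 1) (hψ : ‖ψ‖ = 1)
    (hmn : m + n = 1) (hc : inner ℂ φ ψ = (c : ℂ)) (hM2 : 1 / 2 ≤ M) (hM1 : M ≤ 1)
    (hM : (M - m) * (M - n) = m * n * c ^ 2) {T : H →L[ℂ] H}
    (hT : ∀ v, T v = (m : ℂ) • pureState φ v + (n : ℂ) • pureState ψ v) :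
    vonNeumannEntropy T = ENNReal.ofReal (Real.binEntropy M / Real.log 2) := by
  have hcomplete : CompleteSpace H := FiniteDimensional.complete ℂ H
  have hproper : ProperSpace H := FiniteDimensional.proper ℂ H
  have hcomp : IsCompactOperator T := isCompactOperator_of_locallyCompactSpace_dom T
  have hsymm : (T : H →ₗ[ℂ] H).IsSymmetric := by
    intro x y
    simp only [ContinuousLinearMap.coe_coe, hT, inner_add_left, inner_add_right, inner_smul_left,
      inner_smul_right, pureState_apply, inner_conj_symm, Complex.conj_ofReal]
    ring
  obtain ⟨ι, b, lam, -, hb, hent⟩ := exists_eigenbasis_entropy hcomp hsymm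
  have : Finite ι := b.orthonormal.linearIndependent.finite
  have := Fintype.ofFinite ι
  have hb' := fun i => (hT (b i)).symm.trans (hb i)
  have hnorm := b.orthonormal.1
  have hsq : ∀ χ : H, ‖χ‖ = 1 → ∑ i, ‖inner ℂ χ (b i)‖ ^ 2 = 1 := by
    intro χ hχ
    rw [(hasSum_fintype _).unique (b.hasSum_norm_inner_sq χ), hχ, one_pow]
  have hcross : ∑ i, (inner ℂ φ (b i) * inner ℂ (b i) ψ).re = c := by
    rw [← Complex.re_sum, (hasSum_fintype _).unique (b.hasSum_inner_mul_inner φ ψ), hc,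
      Complex.ofReal_re]
  rw [hent]
  refine tsum_entropyTerm_eq_binEntropy hM2 hM1
    (fun i => eigenvalue_mem hφ hψ (hnorm i) hmn hc hM (hb' i)) ?_ ?_
  · rw [Finset.sum_congr rfl fun i _ => eigenvalue_eq_weighted_sq (hnorm i) (hb' i),
      Finset.sum_add_distrib, ← Finset.mul_sum, ← Finset.mul_sum, hsq φ hφ, hsq ψ hψ]
    linarith
  · rw [Finset.sum_congr rfl fun i _ => eigenvalue_sq_eq hφ hψ (hnorm i) hc (hb' i),
      Finset.sum_add_distrib, Finset.sum_add_distrib, ← Finset.mul_sum, ← Finset.mul_sum,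
      ← Finset.mul_sum, hsq φ hφ, hsq ψ hψ, hcross]
    have hn : n = 1 - m := by linarith
    rw [hn] at hM ⊢
    linarith

end GramEigenvalue

/-! ### The lower bound for all models, and the circuit that attains it. -/

namespace HeraldingCoin

variable {p q : ℝ} {P : Measure (ℤ → Fin 3)}

theorem nextState_eq_one_iff {x : ℕ → Fin 3} : nextState (x 0) = 1 ↔ x ∈ endsInOne := by
  simp [nextState, endsInOne]

theorem nextState_eq_zero_iff {x : ℕ → Fin 3} : nextState (x 0) = 0 ↔ x ∉ endsInOne := by
  simp [nextState, endsInOne]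

/-- Every quantum model of the heralding coin has at least the entropy of a mixture of two pure
states with overlap `√(p (1 - q))`. -/
theorem IsLaw.binEntropy_le_complexity [IsProbabilityMeasure P] (hP : IsLaw p q P)
    (hp : p ∈ Set.Icc (0 : ℝ) 1) (hq : q ∈ Set.Icc (0 : ℝ) 1) (hpq : 0 < p + q) {M : ℝ}
    (hM2 : 1 / 2 ≤ M) (hM1 : M ≤ 1) (hm : statProb p q 1 ≤ M) (hn : statProb p q 0 ≤ M)
    (hM : (M - statProb p q 1) * (M - statProb p q 0) =
      statProb p q 1 * statProb p q 0 * Real.sqrt (p * (1 - q)) ^ 2)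
    {H : Type*} [NormedAddCommGroup H] [InnerProductSpace ℂ H] [CompleteSpace H]
    [TopologicalSpace.SeparableSpace H] {Q : QuantumTuple (Fin 3) H} (hQ : IsQuantumModel P Q) :
    ENNReal.ofReal (Real.binEntropy M / Real.log 2) ≤ Q.complexity P := by
  have : IsProbabilityMeasure (pastLaw P) :=
    Measure.isProbabilityMeasure_map measurable_pastOf.aemeasurable
  have hf : ∀ x, ‖Q.encode x‖ = 1 := fun x => Q.states_unit _ (Q.encode_mem x)
  have hi := integrable_pureState hQ.measurable hf
  obtain ⟨ι, b, lam, hcount, hb, hent⟩ := exists_eigenbasis_entropy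
    (isCompactOperator_integral_pureState hi) (isSymmetric_integral_pureState hi)
  have hgood : ∀ᵐ x ∂(pastLaw P), ∀ a,
      Q.process.OutcomeProb (Q.encode x) a (outProb p q (nextState (x 0)) a) := by
    filter_upwards [hQ.output, hP.nextProb_ae_eq hp hq] with x hx hx2 a
    rw [← hx2]
    exact hx a
  have hov : ∀ᵐ x ∂(pastLaw P), ∀ᵐ y ∂(pastLaw P), x ∈ endsInOne → y ∉ endsInOne →
      ‖inner ℂ (Q.encode x) (Q.encode y)‖ ≤ Real.sqrt (p * (1 - q)) := by
    filter_upwards [hgood] with x hx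
    filter_upwards [hgood] with y hy hxS hyS
    rw [nextState_eq_one_iff.2 hxS] at hx
    rw [nextState_eq_zero_iff.2 hyS] at hy
    have h1 : outProb p q 1 1 * outProb p q 0 1 = p * (1 - q) := by
      simp [outProb, transProb, Fin.sum_univ_two]
      ring
    rw [← h1]
    -- Output `0` is impossible after the past `x` and output `2` after the past `y`, so `1` is the
    -- only common one.
    refine Q.process.norm_inner_le (hx 1) (hy 1) fun a ha => ?_
    have hx' := hx a
    have hy' := hy a
    fin_cases a
    · left
      simpa [outProb, transProb, Fin.sum_univ_two] using hx'
    · exact absurd rfl ha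
    · right
      simpa [outProb, transProb, Fin.sum_univ_two] using hy'
  rw [← hP.measureReal_endsInOne hp hq hpq, ← hP.measureReal_endsInOne_compl hp hq hpq] at hM
  rw [← hP.measureReal_endsInOne hp hq hpq] at hm
  rw [← hP.measureReal_endsInOne_compl hp hq hpq] at hn
  rw [QuantumTuple.complexity, QuantumTuple.averageState, hent]
  refine binEntropy_le_tsum_entropyTerm hM2 hM1 (fun i => ?_) (fun i => ?_)
    (hasSum_eigenvalues_integral_pureState hi hf b hb)
  · rw [eigenvalue_integral_pureState hi (b.orthonormal.1 i) (hb i)]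
    positivity
  · exact eigenvalue_integral_pureState_le hi hf measurableSet_endsInOne hov hm hn hM
      (b.orthonormal.1 i) (hb i)

/-- The code word for a state of the machine. -/
def codeWord (p q : ℝ) (i : Fin 2) : Qutrit := if i = 1 then s₁ q else s₀ p

theorem encode_eq (x : ℕ → Fin 3) : encode p q x = codeWord p q (nextState (x 0)) := by
  by_cases h : x 0 = 1 <;> simp [encode, codeWord, nextState, h]

theorem norm_codeWord_apply_sq (hp : p ∈ Set.Icc (0 : ℝ) 1) (hq : q ∈ Set.Icc (0 : ℝ) 1)
    (i : Fin 2) (a : Fin 3) : ‖codeWord p q i a‖ ^ 2 = outProb p q i a := by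
  have h1 : 0 ≤ 1 - p := sub_nonneg.2 hp.2
  have h2 : 0 ≤ 1 - q := sub_nonneg.2 hq.2
  fin_cases i <;> fin_cases a <;>
    simp [codeWord, s₀, s₁, outProb, transProb, Fin.sum_univ_two, Real.sq_sqrt, h1, h2, hp.1, hq.1]

/-- The code words share only the basis vector `|1⟩`; their overlap saturates the bound valid for
every model. -/
theorem inner_s₁_s₀ (hp : p ∈ Set.Icc (0 : ℝ) 1) :
    inner ℂ (s₁ q) (s₀ p) = ((Real.sqrt (p * (1 - q)) : ℝ) : ℂ) := by
  rw [Real.sqrt_mul hp.1]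
  simp [s₀, s₁, PiLp.inner_apply, Fin.sum_univ_three]

/-- A unitary matrix that sends `|0⟩` to `s₀`. -/
theorem exists_unitary_s₀ (hp : p ∈ Set.Icc (0 : ℝ) 1) : ∃ V : Matrix.unitaryGroup (Fin 3) ℂ,
    Matrix.toEuclideanLin (V : Matrix (Fin 3) (Fin 3) ℂ) (EuclideanSpace.single 0 1) = s₀ p := by
  have h1 : 0 ≤ 1 - p := sub_nonneg.2 hp.2
  have e1 : ((Real.sqrt (1 - p) : ℝ) : ℂ) * (Real.sqrt (1 - p) : ℝ) = 1 - p := by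
    rw [← Complex.ofReal_mul, Real.mul_self_sqrt h1]
    push_cast
    rfl
  have e2 : ((Real.sqrt p : ℝ) : ℂ) * (Real.sqrt p : ℝ) = p := by
    rw [← Complex.ofReal_mul, Real.mul_self_sqrt hp.1]
  refine ⟨⟨!![(Real.sqrt (1 - p) : ℂ), -(Real.sqrt p : ℂ), 0; (Real.sqrt p : ℂ),
    (Real.sqrt (1 - p) : ℂ), 0; 0, 0, 1], Matrix.mem_unitaryGroup_iff.2 ?_⟩, ?_⟩
  · ext i j
    fin_cases i <;> fin_cases j <;>
      simp [Matrix.mul_apply, Fin.sum_univ_three, Matrix.star_apply, e1, e2] <;> ring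
  · ext i
    fin_cases i <;> simp [s₀, Matrix.mulVec, dotProduct, Fin.sum_univ_three]

/-- A unitary matrix that sends `|0⟩` to `s₁`. -/
theorem exists_unitary_s₁ (hq : q ∈ Set.Icc (0 : ℝ) 1) : ∃ V : Matrix.unitaryGroup (Fin 3) ℂ,
    Matrix.toEuclideanLin (V : Matrix (Fin 3) (Fin 3) ℂ) (EuclideanSpace.single 0 1) = s₁ q := by
  have h1 : 0 ≤ 1 - q := sub_nonneg.2 hq.2
  have e1 : ((Real.sqrt (1 - q) : ℝ) : ℂ) * (Real.sqrt (1 - q) : ℝ) = 1 - q := by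
    rw [← Complex.ofReal_mul, Real.mul_self_sqrt h1]
    push_cast
    rfl
  have e2 : ((Real.sqrt q : ℝ) : ℂ) * (Real.sqrt q : ℝ) = q := by
    rw [← Complex.ofReal_mul, Real.mul_self_sqrt hq.1]
  refine ⟨⟨!![0, 0, 1; (Real.sqrt (1 - q) : ℂ), -(Real.sqrt q : ℂ), 0; (Real.sqrt q : ℂ),
    (Real.sqrt (1 - q) : ℂ), 0], Matrix.mem_unitaryGroup_iff.2 ?_⟩, ?_⟩
  · ext i j
    fin_cases i <;> fin_cases j <;>
      simp [Matrix.mul_apply, Fin.sum_univ_three, Matrix.star_apply, e1, e2] <;> ring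
  · ext i
    fin_cases i <;> simp [s₁, Matrix.mulVec, dotProduct, Fin.sum_univ_three]

theorem exists_isGates (hp : p ∈ Set.Icc (0 : ℝ) 1) (hq : q ∈ Set.Icc (0 : ℝ) 1) :
    ∃ Vp Vq : Matrix.unitaryGroup (Fin 3) ℂ, IsGates p q Vp Vq := by
  obtain ⟨V, hV⟩ := exists_unitary_s₀ hp
  obtain ⟨W, hW⟩ := exists_unitary_s₁ hq
  -- Chosen so that the product of the two gates is `W`.
  refine ⟨V, W * V⁻¹, hV, ?_⟩
  rw [← Submonoid.coe_mul, inv_mul_cancel_right]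
  exact hW

variable {Vp Vq : Matrix.unitaryGroup (Fin 3) ℂ}

theorem toEuclideanLin_single_apply (V : Matrix (Fin 3) (Fin 3) ℂ) (i : Fin 3) :
    Matrix.toEuclideanLin V (EuclideanSpace.single 0 1) i = V i 0 := by
  simp [Matrix.toLpLin_apply]

/-- Among the symbols only `1` is odd, so the controlled gate acts exactly when the machine moves to
state `1`. -/
theorem IsGates.pow_mul_apply (hV : IsGates p q Vp Vq) (a i : Fin 3) :
    ((Vq : Matrix (Fin 3) (Fin 3) ℂ) ^ (a.val % 2) * (Vp : Matrix (Fin 3) (Fin 3) ℂ)) i 0 =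
      codeWord p q (nextState a) i := by
  have h0 : (Vp : Matrix (Fin 3) (Fin 3) ℂ) i 0 = s₀ p i := by
    rw [← hV.1, toEuclideanLin_single_apply]
  have h1 : ((Vq : Matrix (Fin 3) (Fin 3) ℂ) * (Vp : Matrix (Fin 3) (Fin 3) ℂ)) i 0 = s₁ q i := by
    rw [← hV.2, toEuclideanLin_single_apply]
  fin_cases a
  · simpa [nextState, codeWord] using h0
  · simpa [nextState, codeWord] using h1
  · simpa [nextState, codeWord] using h0

/-- The circuit maps the memory state `ψ`, for the outcome `a`, to a multiple of the code word of
the state of the machine after `a`. -/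
theorem IsGates.kraus_apply (hV : IsGates p q Vp Vq) (a : Fin 3) (k : Unit) (ψ : Qutrit) :
    (process Vp Vq).kraus a k ψ = ψ a • codeWord p q (nextState a) := by
  ext i
  rw [PiLp.smul_apply, ← hV.pow_mul_apply]
  simp only [process, Matrix.ofLp_toEuclideanCLM, Matrix.mulVec, dotProduct, krausMatrix_apply,
    ite_mul, zero_mul, Finset.sum_ite_eq, Finset.mem_univ, if_true, smul_eq_mul]
  ring

theorem norm_codeWord (hp : p ∈ Set.Icc (0 : ℝ) 1) (hq : q ∈ Set.Icc (0 : ℝ) 1) (i : Fin 2) :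
    ‖codeWord p q i‖ = 1 := by
  unfold codeWord
  split_ifs
  · exact norm_s₁ hq
  · exact norm_s₀ hp

theorem pureState_smul {H : Type*} [NormedAddCommGroup H] [InnerProductSpace ℂ H] (z : ℂ) (ψ : H) :
    pureState (z • ψ) = ((‖z‖ ^ 2 : ℝ) : ℂ) • pureState ψ := by
  ext v
  simp only [pureState_apply, smul_apply, inner_smul_left, smul_smul]
  congr 1
  rw [Complex.ofReal_pow, ← Complex.conj_mul']
  ring

theorem stronglyMeasurable_pureState_encode :
    StronglyMeasurable fun x => pureState (encode p q x) := by
  unfold encode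
  simp only [apply_ite pureState]
  exact StronglyMeasurable.ite measurableSet_endsInOne stronglyMeasurable_const
    stronglyMeasurable_const

theorem IsLaw.isQuantumModel_model [IsProbabilityMeasure P] (hP : IsLaw p q P)
    (hp : p ∈ Set.Icc (0 : ℝ) 1) (hq : q ∈ Set.Icc (0 : ℝ) 1) (hV : IsGates p q Vp Vq) :
    IsQuantumModel P (model p q hp hq Vp Vq) where
  measurable := stronglyMeasurable_pureState_encode.aestronglyMeasurable
  output := by
    filter_upwards [hP.nextProb_ae_eq hp hq] with x hx a
    rw [hx]
    have h : ‖(process Vp Vq).kraus a () (encode p q x)‖ ^ 2 =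
        outProb p q (nextState (x 0)) a := by
      rw [hV.kraus_apply, norm_smul, norm_codeWord hp hq, mul_one, encode_eq,
        norm_codeWord_apply_sq hp hq]
    rw [← h]
    exact hasSum_unique (fun k : Unit => ‖(process Vp Vq).kraus a k (encode p q x)‖ ^ 2)
  transition := by
    filter_upwards [hP.nextProb_ae_eq hp hq] with x hx a _
    rw [hx]
    have h : pureState ((process Vp Vq).kraus a () (encode p q x)) =
        (outProb p q (nextState (x 0)) a : ℂ) • pureState (encode p q (pastSnoc x a)) := by
      rw [hV.kraus_apply, pureState_smul, encode_eq, encode_eq, norm_codeWord_apply_sq hp hq]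
      -- The most recent symbol of `pastSnoc x a` is `a` by definition.
      rfl
    refine Eq.subst (motive := fun σ => HasSum _ σ) h ?_
    exact hasSum_unique (fun k : Unit => pureState ((process Vp Vq).kraus a k (encode p q x)))

theorem IsLaw.averageState_model [IsProbabilityMeasure P] (hP : IsLaw p q P)
    (hp : p ∈ Set.Icc (0 : ℝ) 1) (hq : q ∈ Set.Icc (0 : ℝ) 1) (hpq : 0 < p + q) (v : Qutrit) :
    (model p q hp hq Vp Vq).averageState P v =
      (statProb p q 1 : ℂ) • pureState (s₁ q) v + (statProb p q 0 : ℂ) • pureState (s₀ p) v := by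
  have : IsProbabilityMeasure (pastLaw P) :=
    Measure.isProbabilityMeasure_map measurable_pastOf.aemeasurable
  have hi : Integrable (fun x => pureState (encode p q x)) (pastLaw P) :=
    integrable_pureState stronglyMeasurable_pureState_encode.aestronglyMeasurable fun x => by
      rw [encode_eq, norm_codeWord hp hq]
  have h1 : ∫ x in endsInOne, pureState (encode p q x) v ∂(pastLaw P) =
      (statProb p q 1 : ℂ) • pureState (s₁ q) v := by
    have e : Set.EqOn (fun x => pureState (encode p q x) v) (fun _ => pureState (s₁ q) v)
        endsInOne := fun x hx => by simp only [encode, if_pos (show x 0 = 1 from hx)]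
    rw [setIntegral_congr_fun measurableSet_endsInOne e, setIntegral_const,
      hP.measureReal_endsInOne hp hq hpq, Complex.coe_smul]
  have h0 : ∫ x in endsInOneᶜ, pureState (encode p q x) v ∂(pastLaw P) =
      (statProb p q 0 : ℂ) • pureState (s₀ p) v := by
    have e : Set.EqOn (fun x => pureState (encode p q x) v) (fun _ => pureState (s₀ p) v)
        endsInOneᶜ := fun x hx => by simp only [encode, if_neg (show ¬ x 0 = 1 from hx)]
    rw [setIntegral_congr_fun measurableSet_endsInOne.compl e, setIntegral_const,
      hP.measureReal_endsInOne_compl hp hq hpq, Complex.coe_smul]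
  rw [← h1, ← h0, integral_add_compl measurableSet_endsInOne (hi.apply_continuousLinearMap v)]
  exact ContinuousLinearMap.integral_apply hi v

end HeraldingCoin

end

theorem mainTheorem6 (p q : ℝ) (hp : p ∈ Set.Icc (0 : ℝ) 1) (hq : q ∈ Set.Icc (0 : ℝ) 1)
    (hpq : 0 < p + q) :
    (∃ Vp Vq : Matrix.unitaryGroup (Fin 3) ℂ, HeraldingCoin.IsGates p q Vp Vq) ∧
    ∀ (P : MeasureTheory.Measure (ℤ → Fin 3)) [MeasureTheory.IsProbabilityMeasure P],
      HeraldingCoin.IsLaw p q P →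
      ∀ Vp Vq : Matrix.unitaryGroup (Fin 3) ℂ, HeraldingCoin.IsGates p q Vp Vq →
        IsOptimalQuantumModel.{u} P (HeraldingCoin.model p q hp hq Vp Vq) := by
  refine ⟨HeraldingCoin.exists_isGates hp hq, fun P _ hP Vp Vq hV =>
    ⟨hP.isQuantumModel_model hp hq hV, fun H' _ _ _ _ Q' hQ' => ?_⟩⟩
  have hsum := HeraldingCoin.statProb_add hpq
  have hpq1 : 0 ≤ p * (1 - q) := mul_nonneg hp.1 (sub_nonneg.2 hq.2)
  -- The same `M` gives the exact entropy of the circuit and the lower bound for `Q'`.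
  obtain ⟨M, hM2, hM1, hm, hn, hM⟩ := exists_gram_eigenvalue
    (HeraldingCoin.statProb_nonneg hp hq 1) (HeraldingCoin.statProb_nonneg hp hq 0)
    (by linarith) (c := Real.sqrt (p * (1 - q)))
    (by rw [Real.sq_sqrt hpq1]; nlinarith [hp.1, hp.2, hq.1, hq.2])
  have h : (HeraldingCoin.model p q hp hq Vp Vq).complexity P =
      ENNReal.ofReal (Real.binEntropy M / Real.log 2) :=
    vonNeumannEntropy_mixture (HeraldingCoin.norm_s₁ hq) (HeraldingCoin.norm_s₀ hp)
      (by linarith) (HeraldingCoin.inner_s₁_s₀ hp) hM2 hM1 hM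
      fun v => hP.averageState_model hp hq hpq v
  rw [h]
  exact hP.binEntropy_le_complexity hp hq hpq hM2 hM1 hm hn hM hQ'
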